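/- Let $V$ be a complex vector space of countably infinite dimension, of one of the following types: (A) $V$ is equipped with a countable-dimensional subspace $V_*\subset V^*$ such that the pairing $V_*\times V\to\mathbb C$ is nondegenerate; (BD) $V$ is equipped with a nondegenerate symmetric bilinear form $\omega$; (C) $V$ is equipped with a symplectic bilinear form $\omega$. In types (BD) and (C), put $V_*=\{\omega(v,\cdot):v\in V\}$. Let $GL(\infty)$ be the group of all $g\in GL(V)$ with $g(V_*)=V_*$ that fix pointwise finite-codimensional subspaces of $V$ and of $V_*$. Let $G=GL(\infty)$ in type (A), and let $G=O(\infty)$ resp. $G=Sp(\infty)$ be the subgroup of the elements of $GL(\infty)$ preserving $\omega$ in type (BD) resp. (C). A basis $E$ of $V$ is admissible if its dual family spans $V_*$ (type (A)), resp. if there is an involution $i_E:E\to E$ with at most one fixed point such that $\omega(e,e')\neq0$ if and only if $e'=i_E(e)$ (types (BD), (C)). Let $H(E)\subset G$ be the subgroup of the elements that are diagonal in the admissible basis $E$; these subgroups are the splitting Cartan subgroups of $G$. A splitting parabolic subgroup is a subgroup $P\subset G$ that contains $H(E)$ for some admissible basis $E$ and such that $P\cap G(E_n)$ is a parabolic subgroup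 of $G(E_n)=G\cap GL(\langle E_n\rangle)$ for all $n$, where $E=\bigcup_n E_n$ is a filtration by finite subsets ($i_E$-stable in types (BD), (C)). A generalized flag is a collection $\mathcal F$ of subspaces of $V$ that is totally ordered by inclusion, in which every member has an immediate predecessor or an immediate successor, and such that every nonzero $v\in V$ lies in $F''\setminus F'$ for some consecutive members $F'\subset F''$ of $\mathcal F$; in types (BD), (C) it is moreover required that $F\mapsto F^\perp$ is an involution of $\mathcal F$. It is $E$-compatible if it is fixed by $H(E)$, and weakly $E$-compatible if it is $E'$-compatible for some admissible basis $E'$ such that $E\setminus E'$ and $E'\setminus E$ are finite. A splitting parabolic subgroup $P$ is large if it has only finitely many invariant subspaces in $V$ and is the stabilizer in $G$ of a finite sequence of subspaces $0=F_0\subsetneq F_1\subsetneq\dots\subsetneq F_m=V$ (with $F_k^\perp=F_{m-k}$ in types (BD), (C)), each of which is finite dimensional or finite codimensional. Let $P$ be a splitting parabolic subgroup of $G$ and let $\mathcal F$ be a generalized flag with $P=\mathrm{Stab}_G(\mathcal F)$. Then the following conditions are equivalent: (i) $P$ is large; (ii) $\mathcal F$ is weakly $E$-compatible with every admissible basis $E$;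 (iii) for every admissible basis $E$, $G/P=G\cdot\mathcal F$ contains an $E$-compatible generalized flag; (iv) for every splitting Cartan subgroup $H\subset G$ there is $g\in G$ with $gHg^{-1}\subset P$. -/

import Mathlib

open Module

noncomputable section

namespace FlagInd

variable {V : Type*} [AddCommGroup V] [Module ℂ V]

/-- The additional data on the space `V`, according to type.
Type (A): a countable-dimensional space `Vs` of linear forms whose pairing with `V` is nondegenerate.
Type (BD): a nondegenerate symmetric bilinear form.
Type (C): a symplectic (nondegenerate alternating) bilinear form. -/
inductive ClassicalType (V : Type*) [AddCommGroup V] [Module ℂ V] where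
  | A (Vs : Submodule ℂ (Dual ℂ V)) (countable : Module.rank ℂ Vs = Cardinal.aleph0)
      (nondegenerate : ∀ v : V, (∀ φ ∈ Vs, φ v = 0) → v = 0)
  | BD (ω : LinearMap.BilinForm ℂ V) (symm : ω.IsSymm) (nondegenerate : ω.Nondegenerate)
  | C (ω : LinearMap.BilinForm ℂ V) (alt : ω.IsAlt) (nondegenerate : ω.Nondegenerate)

namespace ClassicalType

/-- The bilinear form in types (BD) and (C); there is none in type (A).
The phrase "in type (BCD)" is expressed by quantifying over `ω ∈ T.form`. -/
def form : ClassicalType V → Option (LinearMap.BilinForm ℂ V)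
  | A _ _ _ => none
  | BD ω _ _ => some ω
  | C ω _ _ => some ω

/-- The subspace `V_*` of the dual space: the given one in type (A),
and `{ω(v, ·) : v ∈ V}` in types (BD) and (C). -/
def Vstar : ClassicalType V → Submodule ℂ (Dual ℂ V)
  | A Vs _ _ => Vs
  | BD ω _ _ => LinearMap.range ω
  | C ω _ _ => LinearMap.range ω

end ClassicalType

/-- The natural action of `GL(V)` on linear forms, `(g φ)(v) = φ(g⁻¹ v)`. -/
def dualAct (g : V ≃ₗ[ℂ] V) : Dual ℂ V →ₗ[ℂ] Dual ℂ V := g.symm.dualMap.toLinearMap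

@[simp] theorem dualAct_apply (g : V ≃ₗ[ℂ] V) (φ : Dual ℂ V) (v : V) :
    dualAct g φ v = φ (g.symm v) := rfl

theorem dualAct_one : dualAct (1 : V ≃ₗ[ℂ] V) = LinearMap.id := rfl

theorem dualAct_mul (g h : V ≃ₗ[ℂ] V) : dualAct (g * h) = dualAct g ∘ₗ dualAct h := rfl

theorem dualAct_inv_comp (g : V ≃ₗ[ℂ] V) : dualAct g⁻¹ ∘ₗ dualAct g = LinearMap.id := by
  rw [← dualAct_mul, inv_mul_cancel, dualAct_one]

/-- `GL(∞)`: the automorphisms of `V` which preserve `Vs` and fix pointwise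
finite-codimensional subspaces of `V` and of `Vs`. -/
def GLInf (Vs : Submodule ℂ (Dual ℂ V)) : Subgroup (V ≃ₗ[ℂ] V) where
  carrier := {g | Vs.map (dualAct g) = Vs ∧
    (∃ U : Submodule ℂ V, FiniteDimensional ℂ (V ⧸ U) ∧ ∀ u ∈ U, g u = u) ∧
    (∃ U : Submodule ℂ Vs, FiniteDimensional ℂ (Vs ⧸ U) ∧
      ∀ φ ∈ U, dualAct g (φ : Dual ℂ V) = φ)}
  one_mem' := by
    refine ⟨by simp [dualAct_one], ⟨⊤, inferInstance, fun _ _ => rfl⟩,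
      ⟨⊤, inferInstance, fun _ _ => rfl⟩⟩
  mul_mem' := by
    rintro g h ⟨g1, ⟨U, hU, gU⟩, ⟨W, hW, gW⟩⟩ ⟨h1, ⟨U', hU', hU'g⟩, ⟨W', hW', hW'g⟩⟩
    refine ⟨by rw [dualAct_mul, Submodule.map_comp, h1, g1], ⟨U ⊓ U', ?_, ?_⟩,
      ⟨W ⊓ W', ?_, ?_⟩⟩
    · exact Submodule.CoFG.inf hU hU'
    · rintro u ⟨hu, hu'⟩
      change g (h u) = u
      rw [hU'g u hu', gU u hu]
    · exact Submodule.CoFG.inf hW hW'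
    · rintro φ ⟨hφ, hφ'⟩
      rw [dualAct_mul, LinearMap.comp_apply, hW'g φ hφ', gW φ hφ]
  inv_mem' := by
    rintro g ⟨g1, ⟨U, hU, gU⟩, ⟨W, hW, gW⟩⟩
    refine ⟨?_, ⟨U, hU, ?_⟩, ⟨W, hW, ?_⟩⟩
    · conv_lhs => rw [← g1]
      rw [← Submodule.map_comp, dualAct_inv_comp, Submodule.map_id]
    · intro u hu
      have h := gU u hu
      calc g⁻¹ u = g.symm (g u) := by rw [h]; rfl
        _ = u := g.symm_apply_apply u
    · intro φ hφ
      have h := congrArg (dualAct g⁻¹) (gW φ hφ)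
      rw [← LinearMap.comp_apply, dualAct_inv_comp] at h
      exact h.symm

/-- The classical ind-group: `GL(∞)` in type (A), and the subgroup `O(∞)` or `Sp(∞)` of the
elements of `GL(∞)` which preserve `ω` in type (BD) or (C). -/
def ClassicalType.G (T : ClassicalType V) : Subgroup (V ≃ₗ[ℂ] V) where
  carrier := {g | g ∈ GLInf T.Vstar ∧ ∀ ω ∈ T.form, ∀ v w : V, ω (g v) (g w) = ω v w}
  one_mem' := ⟨one_mem _, fun _ _ _ _ => rfl⟩
  mul_mem' := by
    rintro g h ⟨hg, hg'⟩ ⟨hh, hh'⟩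
    refine ⟨mul_mem hg hh, fun ω hω v w => ?_⟩
    change ω (g (h v)) (g (h w)) = _
    rw [hg' ω hω, hh' ω hω]
  inv_mem' := by
    rintro g ⟨hg, hg'⟩
    refine ⟨inv_mem hg, fun ω hω v w => ?_⟩
    rw [← hg' ω hω]
    change ω (g (g.symm v)) (g (g.symm w)) = _
    simp

/-- `E ⊆ V` is a basis of the vector space `V`. -/
def IsBasis (E : Set V) : Prop :=
  LinearIndepOn ℂ id E ∧ Submodule.span ℂ E = ⊤

/-- The dual family `E^* = {φ_e : e ∈ E}` of a basis `E`. -/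
def dualFamily (E : Set V) : Set (Dual ℂ V) :=
  {φ | ∃ e ∈ E, φ e = 1 ∧ ∀ e' ∈ E, e' ≠ e → φ e' = 0}

/-- Admissible bases. In type (A) the dual family spans `V_*`; in type (BCD) there is an involution
`i` of `E`, with at most one fixed point, such that `ω(e, e') ≠ 0` if and only if `e' = i(e)`. -/
def ClassicalType.IsAdmissible (T : ClassicalType V) (E : Set V) : Prop :=
  IsBasis E ∧
  match T with
  | .A Vs _ _ => Submodule.span ℂ (dualFamily E) = Vs
  | .BD ω _ _ | .C ω _ _ =>
      ∃ i : E → E, Function.Involutive i ∧ (Function.fixedPoints i).Subsingleton ∧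
        ∀ e e' : E, ω (e : V) (e' : V) ≠ 0 ↔ e' = i e

/-- `H(E)`: the subgroup of the elements of the classical ind-group which are diagonal in `E`. -/
def ClassicalType.H (T : ClassicalType V) (E : Set V) : Subgroup (V ≃ₗ[ℂ] V) where
  carrier := {g | g ∈ T.G ∧ ∀ e ∈ E, ∃ c : ℂ, g e = c • e}
  one_mem' := ⟨one_mem _, fun e _ => ⟨1, by simp⟩⟩
  mul_mem' := by
    rintro g h ⟨hg, hg'⟩ ⟨hh, hh'⟩
    refine ⟨mul_mem hg hh, fun e he => ?_⟩
    obtain ⟨c, hc⟩ := hg' e he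
    obtain ⟨d, hd⟩ := hh' e he
    refine ⟨d * c, ?_⟩
    change g (h e) = _
    rw [hd, map_smul, hc, mul_smul]
  inv_mem' := by
    rintro g ⟨hg, hg'⟩
    refine ⟨inv_mem hg, fun e he => ?_⟩
    obtain ⟨c, hc⟩ := hg' e he
    refine ⟨c⁻¹, ?_⟩
    change g.symm e = _
    rw [LinearEquiv.symm_apply_eq, map_smul, hc, smul_smul]
    by_cases h : c = 0
    · have : e = 0 := by
        apply g.injective
        rw [hc, h, zero_smul, map_zero]
      simp [this]
    · rw [inv_mul_cancel₀ h, one_smul]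

/-- Splitting Cartan subgroups. -/
def ClassicalType.IsSplittingCartan (T : ClassicalType V) (H : Subgroup (V ≃ₗ[ℂ] V)) : Prop :=
  ∃ E : Set V, T.IsAdmissible E ∧ H = T.H E

/-! ### Parabolic subgroups of the finite-dimensional groups `G(E_n)` -/

/-- `GL(⟨s⟩)` for a subset `s` of a basis `E`, viewed as a subgroup of `GL(V)`: the elements which
preserve `⟨s⟩` and fix `E \ s` pointwise. -/
def GLSpan (E s : Set V) : Subgroup (V ≃ₗ[ℂ] V) where
  carrier := {g | (Submodule.span ℂ s).map g.toLinearMap = Submodule.span ℂ s ∧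
    ∀ e ∈ E \ s, g e = e}
  one_mem' := ⟨Submodule.map_id _, fun _ _ => rfl⟩
  mul_mem' := by
    rintro g h ⟨hg, hg'⟩ ⟨hh, hh'⟩
    refine ⟨?_, fun e he => ?_⟩
    · change (Submodule.span ℂ s).map (g.toLinearMap ∘ₗ h.toLinearMap) = _
      rw [Submodule.map_comp, hh, hg]
    · change g (h e) = e
      rw [hh' e he, hg' e he]
  inv_mem' := by
    rintro g ⟨hg, hg'⟩
    refine ⟨?_, fun e he => ?_⟩
    · conv_lhs => rw [← hg]
      change ((Submodule.span ℂ s).map g.toLinearMap).map g.symm.toLinearMap = _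
      rw [← Submodule.map_comp, LinearEquiv.symm_comp, Submodule.map_id]
    · change g.symm e = e
      rw [LinearEquiv.symm_apply_eq, hg' e he]

/-- The topology on `GL(V)` whose basic open sets are the nonvanishing sets of polynomials in the
matrix coefficients `g ↦ φ(g v)`. On a subgroup `GL(⟨s⟩)` with `s` a finite subset of a basis, the
matrix coefficients are the affine functions of the matrix entries, so that the
induced topology is the usual Zariski topology. -/
abbrev zariski (V : Type*) [AddCommGroup V] [Module ℂ V] : TopologicalSpace (V ≃ₗ[ℂ] V) :=
  TopologicalSpace.generateFrom
    {U | ∃ p : MvPolynomial (Dual ℂ V × V) ℂ,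
      U = {g | MvPolynomial.eval (fun x => x.1 (g x.2)) p ≠ 0}}

/-- `K` is a Zariski closed subgroup of `A`. -/
def IsClosedSubgroup (A K : Subgroup (V ≃ₗ[ℂ] V)) : Prop :=
  K ≤ A ∧ ∃ C : Set (V ≃ₗ[ℂ] V), @IsClosed _ (zariski V) C ∧
    (K : Set (V ≃ₗ[ℂ] V)) = (A : Set (V ≃ₗ[ℂ] V)) ∩ C

/-- Borel subgroups: maximal connected solvable closed subgroups. -/
def IsBorel (A B : Subgroup (V ≃ₗ[ℂ] V)) : Prop :=
  Maximal (fun K : Subgroup (V ≃ₗ[ℂ] V) => IsClosedSubgroup A K ∧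
    @IsConnected _ (zariski V) (K : Set (V ≃ₗ[ℂ] V)) ∧ Group.IsSolvable K) B

/-- Parabolic subgroups: closed subgroups which contain a Borel subgroup. -/
def IsParabolic (A Q : Subgroup (V ≃ₗ[ℂ] V)) : Prop :=
  IsClosedSubgroup A Q ∧ ∃ B, IsBorel A B ∧ B ≤ Q

/-- A filtration of the admissible basis `E` by finite subsets, which are stable by the involution
`i_E` in type (BCD). -/
structure ClassicalType.IsFiltration (T : ClassicalType V) (E : Set V) (s : ℕ → Set V) : Prop where
  mono : Monotone s
  finite : ∀ n, (s n).Finite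
  iUnion : ⋃ n, s n = E
  stable : ∀ ω ∈ T.form, ∀ n, ∀ e ∈ s n, ∀ e' ∈ E, ω e e' ≠ 0 → e' ∈ s n

/-- Splitting parabolic subgroups: `P` contains `H(E)` for some admissible basis `E`, and
`P ∩ G(E_n)` is a parabolic subgroup of `G(E_n) = G ∩ GL(⟨E_n⟩)` for all `n`. -/
def ClassicalType.IsSplittingParabolic (T : ClassicalType V) (P : Subgroup (V ≃ₗ[ℂ] V)) : Prop :=
  P ≤ T.G ∧ ∃ E : Set V, T.IsAdmissible E ∧ T.H E ≤ P ∧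
    ∃ s : ℕ → Set V, T.IsFiltration E s ∧
      ∀ n, IsParabolic (T.G ⊓ GLSpan E (s n)) (P ⊓ (T.G ⊓ GLSpan E (s n)))

/-! ### Generalized flags -/

/-- `F'` and `F''` are consecutive members of `𝓕`, with `F' ⊂ F''`. -/
def IsConsecutive (𝓕 : Set (Submodule ℂ V)) (F' F'' : Submodule ℂ V) : Prop :=
  F' ∈ 𝓕 ∧ F'' ∈ 𝓕 ∧ F' < F'' ∧ ∀ K ∈ 𝓕, ¬ (F' < K ∧ K < F'')

/-- Generalized flags (isotropic ones in type (BCD)). -/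
structure ClassicalType.IsGeneralizedFlag (T : ClassicalType V) (𝓕 : Set (Submodule ℂ V)) :
    Prop where
  total : ∀ F ∈ 𝓕, ∀ K ∈ 𝓕, F ≤ K ∨ K ≤ F
  neighbor : ∀ F ∈ 𝓕, (∃ K, IsConsecutive 𝓕 K F) ∨ (∃ K, IsConsecutive 𝓕 F K)
  separates : ∀ v : V, v ≠ 0 → ∃ F' F'', IsConsecutive 𝓕 F' F'' ∧ v ∈ F'' ∧ v ∉ F'
  isotropic : ∀ ω ∈ T.form, ∀ F ∈ 𝓕, ω.orthogonal F ∈ 𝓕 ∧ ω.orthogonal (ω.orthogonal F) = F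

/-- The action of `GL(V)` on collections of subspaces. -/
def flagMap (g : V ≃ₗ[ℂ] V) (𝓕 : Set (Submodule ℂ V)) : Set (Submodule ℂ V) :=
  (fun F => F.map g.toLinearMap) '' 𝓕

theorem flagMap_one (𝓕 : Set (Submodule ℂ V)) : flagMap 1 𝓕 = 𝓕 := by
  have h : (fun F : Submodule ℂ V => F.map (1 : V ≃ₗ[ℂ] V).toLinearMap) = id := by
    funext F
    exact Submodule.map_id F
  rw [flagMap, h, Set.image_id]

theorem flagMap_mul (g h : V ≃ₗ[ℂ] V) (𝓕 : Set (Submodule ℂ V)) :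
    flagMap (g * h) 𝓕 = flagMap g (flagMap h 𝓕) := by
  rw [flagMap, flagMap, flagMap, Set.image_image]
  refine Set.image_congr fun F _ => ?_
  change F.map (g.toLinearMap ∘ₗ h.toLinearMap) = _
  rw [Submodule.map_comp]

/-- The stabilizer of a collection of subspaces in the classical ind-group. -/
def ClassicalType.Stab (T : ClassicalType V) (𝓕 : Set (Submodule ℂ V)) :
    Subgroup (V ≃ₗ[ℂ] V) where
  carrier := {g | g ∈ T.G ∧ flagMap g 𝓕 = 𝓕}
  one_mem' := ⟨one_mem _, flagMap_one 𝓕⟩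
  mul_mem' := by
    rintro g h ⟨hg, hg'⟩ ⟨hh, hh'⟩
    exact ⟨mul_mem hg hh, by rw [flagMap_mul, hh', hg']⟩
  inv_mem' := by
    rintro g ⟨hg, hg'⟩
    refine ⟨inv_mem hg, ?_⟩
    conv_lhs => rw [← hg']
    rw [← flagMap_mul, inv_mul_cancel, flagMap_one]

/-- The orbit `G · 𝓕`, which is the realization of `G/P` for `P = Stab_G(𝓕)`. -/
def ClassicalType.flagOrbit (T : ClassicalType V) (𝓕 : Set (Submodule ℂ V)) :
    Set (Set (Submodule ℂ V)) :=
  {𝓖 | ∃ g ∈ T.G, 𝓖 = flagMap g 𝓕}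

/-- `𝓕` is `E`-compatible if it is fixed by `H(E)`. -/
def ClassicalType.IsCompatible (T : ClassicalType V) (E : Set V) (𝓕 : Set (Submodule ℂ V)) :
    Prop :=
  ∀ h ∈ T.H E, flagMap h 𝓕 = 𝓕

/-- `𝓕` is weakly `E`-compatible if it is compatible with an admissible basis which differs
from `E` by finitely many vectors. -/
def ClassicalType.IsWeaklyCompatible (T : ClassicalType V) (E : Set V)
    (𝓕 : Set (Submodule ℂ V)) : Prop :=
  ∃ E' : Set V, T.IsAdmissible E' ∧ (E' \ E).Finite ∧ (E \ E').Finite ∧ T.IsCompatible E' 𝓕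

/-! ### Large parabolic subgroups -/

/-- `P` has only finitely many invariant subspaces in `V`. -/
def IsSemilarge (P : Subgroup (V ≃ₗ[ℂ] V)) : Prop :=
  {W : Submodule ℂ V | ∀ g ∈ P, W.map g.toLinearMap ≤ W}.Finite

/-- `P` is the stabilizer in `G` of the finite sequence of subspaces
`0 = F_0 ⊊ F_1 ⊊ … ⊊ F_m = V` (such that `F_k^⊥ = F_{m-k}` in type (BCD)). -/
structure ClassicalType.IsStabilizerOfChain (T : ClassicalType V) (P : Subgroup (V ≃ₗ[ℂ] V))
    {m : ℕ} (F : Fin (m + 1) → Submodule ℂ V) : Prop where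
  strictMono : StrictMono F
  zero : F 0 = ⊥
  last : F (Fin.last m) = ⊤
  orthogonal : ∀ ω ∈ T.form, ∀ k, ω.orthogonal (F k) = F k.rev
  mem_iff : ∀ g, g ∈ P ↔ g ∈ T.G ∧ ∀ k, (F k).map g.toLinearMap = F k

/-- `P` is large: it is semilarge and, moreover, it is the stabilizer of a finite sequence of
subspaces each of which is finite dimensional or finite codimensional. -/
def ClassicalType.IsLarge (T : ClassicalType V) (P : Subgroup (V ≃ₗ[ℂ] V)) : Prop :=
  IsSemilarge P ∧ ∃ (m : ℕ) (F : Fin (m + 1) → Submodule ℂ V), T.IsStabilizerOfChain P F ∧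
    ∀ k, FiniteDimensional ℂ (F k) ∨ FiniteDimensional ℂ (V ⧸ F k)

end FlagInd

end

open Module

noncomputable section

namespace FlagInd

variable {V : Type*} [AddCommGroup V] [Module ℂ V]

/-! ### Bases and dual families -/

/-! Fix an admissible basis `E₀` with `H(E₀) ⊂ P`. An `H(E₀)`-stable subspace is spanned by the
elements of `E₀` it contains, so `𝓕` is encoded by subsets of `E₀`. All conditions are compared with
a combinatorial one, `IsNearlyTrivial`: outside one finite set `Z ⊂ E₀`, every member of `𝓕`
contains all basis vectors or none ("large" or "small" members).

Large implies nearly trivial: the subspaces of the chain defining `P` contain almost all or almost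
no basis vectors, so elements of `G` exchanging two vectors outside a finite set can be chosen to
stabilize the chain. They lie in `P`, hence stabilize `𝓕` (`exists_exchange`,
`IsLarge.isNearlyTrivial`). The same exchanges, read backwards, show that a nearly trivial flag has
a semilarge stabilizer and is itself a finite chain (`IsNearlyTrivial.isLarge`).

Nearly trivial implies (iii): the flag is determined by finite data. In type (A) these are the
finitely many basis vectors in small members and the finitely many coordinate forms cutting out the
large ones; an element of `G` moves both into `E` and its dual family. In types (BCD) the small
members are isotropic and the large ones are their orthogonals, so it suffices to move a finite
isotropic set into `E` (`exists_map_compatible`).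

(iii) implies (ii) because an element of `G` fixes almost all elements of an admissible basis; (iii)
and (iv) differ by conjugation.

(ii) implies nearly trivial: otherwise `𝓕` separates infinitely many disjoint pairs `e_n ∈ F_n`,
`f_n ∉ F_n`. A shear of infinite rank produces an admissible basis containing all `f_n` and `e_n +
f_n`. A basis differing from it in finitely many vectors still contains such a pair for some `n`,
and a compatible `F_n` containing `e_n = (e_n + f_n) - f_n` would contain `f_n`. -/

/-- The basis of `V` indexed by a set which is a basis. -/
def IsBasis.basis {E : Set V} (hE : IsBasis E) : Basis E ℂ V :=
  Basis.mk (v := fun e : E => (e : V)) hE.1 (by rw [Subtype.range_coe]; exact hE.2.ge)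

@[simp] theorem IsBasis.basis_apply {E : Set V} (hE : IsBasis E) (e : E) :
    hE.basis e = (e : V) := by
  exact Basis.mk_apply (v := fun e : E => (e : V)) _ _ e

theorem isBasis_range {ι : Type*} (b : Basis ι ℂ V) : IsBasis (Set.range b) :=
  ⟨b.linearIndependent.linearIndepOn_id, b.span_eq⟩

theorem IsBasis.ext {E : Set V} (hE : IsBasis E) {φ ψ : Dual ℂ V} (h : ∀ e ∈ E, φ e = ψ e) :
    φ = ψ := by
  refine hE.basis.ext fun e => ?_
  simpa using h e e.2

theorem IsBasis.coord_self {E : Set V} (hE : IsBasis E) (e : E) : hE.basis.coord e e = 1 := by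
  have := hE.basis.coord_apply e (hE.basis e)
  rw [hE.basis.repr_self, Finsupp.single_eq_same, hE.basis_apply] at this
  exact this

theorem IsBasis.coord_ne {E : Set V} (hE : IsBasis E) {e f : E} (h : f ≠ e) :
    hE.basis.coord e f = 0 := by
  have := hE.basis.coord_apply e (hE.basis f)
  rw [hE.basis.repr_self, Finsupp.single_eq_of_ne h.symm, hE.basis_apply] at this
  exact this

theorem IsBasis.dualFamily_eq {E : Set V} (hE : IsBasis E) :
    dualFamily E = Set.range hE.basis.coord := by
  ext φ
  constructor
  · rintro ⟨e, he, h1, h0⟩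
    refine ⟨⟨e, he⟩, hE.ext fun f hf => ?_⟩
    by_cases hfe : f = e
    · subst hfe
      rw [h1]
      exact hE.coord_self ⟨f, hf⟩
    · rw [h0 f hf hfe]
      exact hE.coord_ne (e := ⟨e, he⟩) (f := ⟨f, hf⟩) fun h => hfe (congrArg Subtype.val h)
  · rintro ⟨e, rfl⟩
    exact ⟨e, e.2, hE.coord_self e, fun f hf hfe =>
      hE.coord_ne (f := ⟨f, hf⟩) fun h => hfe (congrArg Subtype.val h)⟩

theorem IsBasis.finite_coord_ne_zero {E : Set V} (hE : IsBasis E) (v : V) :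
    {e : E | hE.basis.coord e v ≠ 0}.Finite := by
  refine (hE.basis.repr v).hasFiniteSupport.subset fun e he => ?_
  simpa using he

theorem IsBasis.infinite (hV : Module.rank ℂ V = Cardinal.aleph0) {E : Set V}
    (hE : IsBasis E) : E.Infinite := by
  rw [← Set.infinite_coe_iff, Cardinal.infinite_iff, ← hV, hE.basis.mk_eq_rank'']

theorem IsBasis.mem_span_iff {E S : Set V} (hE : IsBasis E) (hS : S ⊆ E) (v : V) :
    v ∈ Submodule.span ℂ S ↔ ∀ e : E, hE.basis.coord e v ≠ 0 → (e : V) ∈ S := by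
  have h : hE.basis '' {e : E | (e : V) ∈ S} = S := by
    ext x
    constructor
    · rintro ⟨e, he, rfl⟩
      simpa using he
    · intro hx
      exact ⟨⟨x, hS hx⟩, hx, by simp⟩
  rw [← h, hE.basis.mem_span_image, h]
  constructor
  · intro H e he
    exact H (by simpa using he)
  · intro H e he
    exact H e (by simpa using he)

/-! ### Types (BCD) -/

/-- In type (BCD), the form `ω` of `T` is `ε`-symmetric with `ε = ± 1`. -/
structure IsForm (T : ClassicalType V) (ω : LinearMap.BilinForm ℂ V) (ε : ℂ) : Prop where
  form : T.form = some ω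
  vstar : T.Vstar = LinearMap.range ω
  eps : ε * ε = 1
  symm : ∀ x y, ω x y = ε * ω y x
  self : ε = 1 ∨ ∀ x, ω x x = 0
  admissible_iff : ∀ E, T.IsAdmissible E ↔ IsBasis E ∧
      ∃ i : E → E, Function.Involutive i ∧ (Function.fixedPoints i).Subsingleton ∧
        ∀ e e' : E, ω (e : V) (e' : V) ≠ 0 ↔ e' = i e

theorem ClassicalType.cases (T : ClassicalType V) :
    (∃ Vs h1 h2, T = .A Vs h1 h2) ∨ ∃ ω ε, IsForm T ω ε := by
  rcases T with ⟨Vs, h1, h2⟩ | ⟨ω, h, h'⟩ | ⟨ω, h, h'⟩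
  · exact Or.inl ⟨Vs, h1, h2, rfl⟩
  · exact Or.inr ⟨ω, 1, rfl, rfl, by norm_num, fun x y => by simpa using h.eq x y, Or.inl rfl,
      fun E => Iff.rfl⟩
  · exact Or.inr ⟨ω, -1, rfl, rfl, by norm_num, fun x y => by rw [← LinearMap.IsAlt.neg h, neg_one_mul],
      Or.inr h, fun E => Iff.rfl⟩

section Form

variable {T : ClassicalType V} {ω : LinearMap.BilinForm ℂ V} {ε : ℂ}

theorem IsForm.eps_ne_zero (hω : IsForm T ω ε) : ε ≠ 0 := by
  rintro rfl
  simpa using hω.eps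

theorem IsForm.eq_zero_comm (hω : IsForm T ω ε) {x y : V} : ω x y = 0 ↔ ω y x = 0 := by
  rw [hω.symm x y, mul_eq_zero, or_iff_right hω.eps_ne_zero]

theorem IsForm.ne_zero_comm (hω : IsForm T ω ε) {x y : V} : ω x y ≠ 0 ↔ ω y x ≠ 0 :=
  not_congr hω.eq_zero_comm

theorem IsForm.mem_vstar (hω : IsForm T ω ε) (v : V) : ω v ∈ T.Vstar := by
  rw [hω.vstar]
  exact ⟨v, rfl⟩

theorem IsForm.mem_G_iff (hω : IsForm T ω ε) {g : V ≃ₗ[ℂ] V} :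
    g ∈ T.G ↔ g ∈ GLInf T.Vstar ∧ ∀ v w, ω (g v) (g w) = ω v w := by
  change (g ∈ GLInf T.Vstar ∧ ∀ ω ∈ T.form, ∀ v w : V, ω (g v) (g w) = ω v w) ↔ _
  simp [hω.form]

/-- `ω(e, v) = ω(e, i e) (i e)^*(v)`. -/
theorem IsForm.apply_left {E : Set V} (hE : IsBasis E) {i : E → E}
    (hi : ∀ e e' : E, ω (e : V) (e' : V) ≠ 0 ↔ e' = i e) (e : E) (v : V) :
    ω e v = ω e (i e) * hE.basis.coord (i e) v := by
  have : ω e = ω e (i e) • hE.basis.coord (i e) := by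
    refine hE.ext fun f hf => ?_
    by_cases h : (⟨f, hf⟩ : E) = i e
    · rw [← h]
      have := hE.coord_self ⟨f, hf⟩
      simp only [LinearMap.smul_apply, this, smul_eq_mul, mul_one]
    · have h2 := hE.coord_ne h
      have h1 := not_not.1 (mt (hi e ⟨f, hf⟩).1 h)
      simp only [LinearMap.smul_apply] at h1 h2 ⊢
      rw [h1, h2, smul_zero]
  exact congrArg (fun φ : Dual ℂ V => φ v) this

end Form

theorem ClassicalType.IsAdmissible.isBasis {T : ClassicalType V} {E : Set V}
    (hE : T.IsAdmissible E) : IsBasis E :=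
  hE.1

/-- In all types, `V_*` is spanned by the dual family of any admissible basis. -/
theorem ClassicalType.IsAdmissible.span_coord {T : ClassicalType V} {E : Set V}
    (hE : T.IsAdmissible E) : Submodule.span ℂ (Set.range hE.isBasis.basis.coord) = T.Vstar := by
  rcases T.cases with ⟨Vs, h1, h2, rfl⟩ | ⟨ω, ε, hω⟩
  · rw [← hE.isBasis.dualFamily_eq]
    exact hE.2
  · obtain ⟨hb, i, hi, -, hi'⟩ := (hω.admissible_iff E).1 hE
    have key : ∀ e : E, ω e = ω e (i e) • hE.isBasis.basis.coord (i e) := fun e =>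
      LinearMap.ext fun v => IsForm.apply_left hE.isBasis hi' e v
    rw [hω.vstar]
    apply le_antisymm
    · rw [Submodule.span_le]
      rintro _ ⟨e, rfl⟩
      have h := key (i e)
      have h0 := (hi' (i e) (i (i e))).2 rfl
      rw [hi e] at h h0
      refine ⟨(ω (i e) e)⁻¹ • (i e : V), ?_⟩
      rw [map_smul, inv_smul_eq_iff₀ h0]
      exact h
    · rw [LinearMap.range_eq_map, ← hE.isBasis.2, Submodule.map_span, Submodule.span_le]
      rintro _ ⟨e, he, rfl⟩
      have := key ⟨e, he⟩
      rw [SetLike.mem_coe, this]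
      exact Submodule.smul_mem _ _ (Submodule.subset_span ⟨_, rfl⟩)

theorem ClassicalType.IsAdmissible.coord_mem {T : ClassicalType V} {E : Set V}
    (hE : T.IsAdmissible E) (e : E) : hE.isBasis.basis.coord e ∈ T.Vstar := by
  rw [← hE.span_coord]
  exact Submodule.subset_span ⟨e, rfl⟩

/-- Elements of `V_*` vanish at almost all elements of an admissible basis. -/
theorem ClassicalType.IsAdmissible.finite_ne_zero {T : ClassicalType V} {E : Set V}
    (hE : T.IsAdmissible E) {φ : Dual ℂ V} (hφ : φ ∈ T.Vstar) : {e ∈ E | φ e ≠ 0}.Finite := by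
  rw [← hE.span_coord] at hφ
  induction hφ using Submodule.span_induction with
  | mem φ h =>
    obtain ⟨e, rfl⟩ := h
    refine (Set.finite_singleton (e : V)).subset ?_
    rintro f ⟨hf, h⟩
    by_contra hfe
    exact h (hE.isBasis.coord_ne (f := ⟨f, hf⟩) fun h => hfe (congrArg Subtype.val h))
  | zero => simp
  | add φ ψ _ _ h1 h2 =>
    refine (h1.union h2).subset ?_
    rintro e ⟨he, h⟩
    by_contra h'
    simp only [Set.mem_union, Set.mem_ofPred_eq, he, true_and, not_or, not_not] at h'
    exact h (by simp [h'.1, h'.2])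
  | smul c φ _ h1 =>
    refine h1.subset ?_
    rintro e ⟨he, h⟩
    exact ⟨he, fun h' => h (by simp [h'])⟩

/-! ### Elements of `GL(∞)` -/

/-- The map `1 + φ ⊗ v` is invertible exactly when `1 + φ v ≠ 0`. Reflections, transvections and
diagonal elements of `G` are all built below from such maps. -/
theorem exists_rankOne {Vs : Submodule ℂ (Dual ℂ V)} {φ : Dual ℂ V} (hφ : φ ∈ Vs) (v : V)
    (h : 1 + φ v ≠ 0) : ∃ g ∈ GLInf Vs, (∀ x, g x = x + φ x • v) ∧
      ∀ x, g.symm x = x - (φ x / (1 + φ v)) • v := by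
  let f : V →ₗ[ℂ] V := LinearMap.id + φ.smulRight v
  let f' : V →ₗ[ℂ] V := LinearMap.id - (φ.smulRight ((1 + φ v)⁻¹ • v))
  have hf : ∀ x, f x = x + φ x • v := fun x => by simp [f]
  have hf' : ∀ x, f' x = x - (φ x / (1 + φ v)) • v := fun x => by
    simp [f', smul_smul, div_eq_mul_inv]
  let g : V ≃ₗ[ℂ] V := LinearEquiv.ofLinearMap f f'
    (by
      ext x
      simp only [LinearMap.comp_apply, hf, hf', LinearMap.id_apply, map_sub, map_smul, smul_eq_mul]
      rw [sub_add, ← sub_smul]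
      rw [show φ x / (1 + φ v) - (φ x - φ x / (1 + φ v) * φ v) = 0 by field_simp; ring]
      simp)
    (by
      ext x
      simp only [LinearMap.comp_apply, hf, hf', LinearMap.id_apply, map_add, map_smul, smul_eq_mul]
      rw [show (φ x + φ x * φ v) / (1 + φ v) = φ x by field_simp]
      simp)
  have hg : ∀ x, g x = x + φ x • v := hf
  have hg' : ∀ x, g.symm x = x - (φ x / (1 + φ v)) • v := hf'
  refine ⟨g, ⟨?_, ⟨LinearMap.ker φ, ?_, ?_⟩,
    ⟨LinearMap.ker ((Dual.eval ℂ V v).comp Vs.subtype), ?_, ?_⟩⟩, hg, hg'⟩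
  · apply le_antisymm
    · rw [Submodule.map_le_iff_le_comap]
      intro ψ hψ
      have : dualAct g ψ = ψ - (ψ v / (1 + φ v)) • φ := by
        ext x
        simp only [dualAct_apply, hg', map_sub, map_smul, smul_eq_mul, LinearMap.sub_apply,
          LinearMap.smul_apply]
        ring
      rw [Submodule.mem_comap, this]
      exact sub_mem hψ (Vs.smul_mem _ hφ)
    · intro ψ hψ
      refine ⟨ψ + ψ v • φ, add_mem hψ (Vs.smul_mem _ hφ), ?_⟩
      ext x
      simp only [dualAct_apply, hg', map_sub, map_smul, smul_eq_mul, LinearMap.add_apply,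
          LinearMap.smul_apply]
      field_simp
      ring
  · exact (LinearMap.quotKerEquivRange φ).symm.finiteDimensional
  · intro u hu
    rw [LinearMap.mem_ker] at hu
    rw [hg, hu, zero_smul, add_zero]
  · exact (LinearMap.quotKerEquivRange _).symm.finiteDimensional
  · rintro ψ hψ
    have hψ' : (ψ : Dual ℂ V) v = 0 := hψ
    ext x
    simp [hg', hψ']

theorem GLInf.finiteDimensional_range_sub {Vs : Submodule ℂ (Dual ℂ V)} {g : V ≃ₗ[ℂ] V}
    (hg : g ∈ GLInf Vs) : FiniteDimensional ℂ (LinearMap.range (g.toLinearMap - LinearMap.id)) := by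
  obtain ⟨-, ⟨U, hU, h⟩, -⟩ := hg
  have hle : U ≤ LinearMap.ker (g.toLinearMap - LinearMap.id) := fun u hu => by
    simp [h u hu]
  rw [← Submodule.range_liftQ U _ hle]
  infer_instance

/-- The image `R` of `g - 1` is finite dimensional, and `g` maps `R ⊓ F` injectively, hence
bijectively, to itself. So `g x - x = g y` with `y ∈ F`, and `x = g (x - y)`. -/
theorem GLInf.map_eq_of_map_le {Vs : Submodule ℂ (Dual ℂ V)} {g : V ≃ₗ[ℂ] V}
    (hg : g ∈ GLInf Vs) {F : Submodule ℂ V} (h : F.map g.toLinearMap ≤ F) :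
    F.map g.toLinearMap = F := by
  have := GLInf.finiteDimensional_range_sub hg
  refine le_antisymm h fun x hx => ?_
  set R := LinearMap.range (g.toLinearMap - LinearMap.id)
  have hR : ∀ y, g y - y ∈ R := fun y => ⟨y, by simp⟩
  have hle : (R ⊓ F).map g.toLinearMap ≤ R ⊓ F := by
    rintro _ ⟨y, ⟨hy, hy'⟩, rfl⟩
    refine ⟨?_, h ⟨y, hy', rfl⟩⟩
    have := add_mem (hR y) hy
    simpa using this
  have : FiniteDimensional ℂ (R ⊓ F : Submodule ℂ V) := Submodule.finiteDimensional_inf_left R F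
  have heq := Submodule.eq_of_le_of_finrank_eq hle (LinearEquiv.finrank_map_eq g _)
  have hgx : g x ∈ F := h ⟨x, hx, rfl⟩
  have : g x - x ∈ R ⊓ F := ⟨hR x, sub_mem hgx hx⟩
  rw [← heq] at this
  obtain ⟨y, ⟨-, hy⟩, hy'⟩ := this
  refine ⟨x - y, sub_mem hx hy, ?_⟩
  rw [map_sub, hy']
  simp

/-- An element stabilizing the chain could a priori shift its members. But `F` and `g F` are
comparable, and an inclusion between them is an equality by `GLInf.map_eq_of_map_le`, applied to `g`
or `g⁻¹`. -/
theorem ClassicalType.mem_Stab_iff {T : ClassicalType V} {𝓕 : Set (Submodule ℂ V)}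
    (h𝓕 : ∀ F ∈ 𝓕, ∀ K ∈ 𝓕, F ≤ K ∨ K ≤ F) {g : V ≃ₗ[ℂ] V} :
    g ∈ T.Stab 𝓕 ↔ g ∈ T.G ∧ ∀ F ∈ 𝓕, F.map g.toLinearMap = F := by
  constructor
  · rintro ⟨hg, hgF⟩
    refine ⟨hg, fun F hF => ?_⟩
    have hF' : F.map g.toLinearMap ∈ 𝓕 := by
      have : F.map g.toLinearMap ∈ flagMap g 𝓕 := ⟨F, hF, rfl⟩
      rwa [hgF] at this
    rcases h𝓕 _ hF' _ hF with h | h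
    · exact GLInf.map_eq_of_map_le hg.1 h
    · have hinv : (F.map g.toLinearMap).map (g⁻¹).toLinearMap = F := by
        rw [← Submodule.map_comp]
        exact (congrArg (F.map ·) (LinearEquiv.symm_comp g)).trans (Submodule.map_id F)
      have h' : F.map (g⁻¹).toLinearMap ≤ F := by
        conv_rhs => rw [← hinv]
        exact Submodule.map_mono h
      have := GLInf.map_eq_of_map_le (inv_mem hg.1) h'
      conv_lhs => rw [← this]
      rw [← Submodule.map_comp]
      exact (congrArg (F.map ·) (LinearEquiv.comp_symm g)).trans (Submodule.map_id F)
  · rintro ⟨hg, h⟩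
    refine ⟨hg, ?_⟩
    ext F
    constructor
    · rintro ⟨K, hK, rfl⟩
      simpa only [h K hK] using hK
    · exact fun hF => ⟨F, hF, h F hF⟩

/-- The elements of `G` fix almost all elements of an admissible basis. -/
theorem ClassicalType.IsAdmissible.finite_not_fixed {T : ClassicalType V} {E : Set V}
    (hE : T.IsAdmissible E) {g : V ≃ₗ[ℂ] V} (hg : g ∈ T.G) : {e ∈ E | g e ≠ e}.Finite := by
  have := GLInf.finiteDimensional_range_sub hg.1
  set R := LinearMap.range (g.toLinearMap - LinearMap.id)
  obtain ⟨s, hs⟩ := (Submodule.fg_iff_finiteDimensional R).2 this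
  have hfin : {e : E | ∃ r ∈ s, hE.isBasis.basis.coord e r ≠ 0}.Finite := by
    have : {e : E | ∃ r ∈ s, hE.isBasis.basis.coord e r ≠ 0} =
        ⋃ r ∈ s, {e : E | hE.isBasis.basis.coord e r ≠ 0} := by ext; simp
    rw [this]
    exact s.finite_toSet.biUnion fun r _ => hE.isBasis.finite_coord_ne_zero r
  have hcoord : ∀ f : E, (∀ r ∈ s, hE.isBasis.basis.coord f r = 0) → ∀ r ∈ R,
      hE.isBasis.basis.coord f r = 0 := by
    intro f hf r hr
    rw [← hs] at hr
    exact (Submodule.span_le (p := LinearMap.ker (hE.isBasis.basis.coord f))).2 hf hr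
  -- `φ ∘ (g - 1) = g⁻¹ φ - φ`.
  have hmem : ∀ φ ∈ T.Vstar, φ ∘ₗ (g.toLinearMap - LinearMap.id) ∈ T.Vstar := by
    intro φ hφ
    have h := (inv_mem hg.1).1
    have h' : dualAct g⁻¹ φ ∈ T.Vstar := by
      rw [← h]
      exact ⟨φ, hφ, rfl⟩
    have := sub_mem h' hφ
    convert this using 1
    ext x
    simp only [LinearMap.comp_apply, LinearMap.sub_apply, map_sub, LinearMap.id_apply,
      dualAct_apply]
    rfl
  -- Only finitely many coordinate forms are nonzero on the image of `g - 1`, and each of them,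
  -- composed with `g - 1`, lies in `V_*` and so vanishes at almost all basis vectors.
  refine (hfin.biUnion fun f _ => hE.finite_ne_zero (hmem _ (hE.coord_mem f))).subset ?_
  rintro e ⟨he, hge⟩
  by_contra hcon
  refine hge (sub_eq_zero.1 (hE.isBasis.basis.ext_elem fun f => ?_))
  by_cases hf : ∃ r ∈ s, hE.isBasis.basis.coord f r ≠ 0
  · by_contra h
    refine hcon (Set.mem_biUnion hf ⟨he, ?_⟩)
    simpa using h
  · push Not at hf
    have := hcoord f hf (g e - e) ⟨e, by simp⟩
    simpa using this

/-! ### Moving vectors -/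

section Form

variable {T : ClassicalType V} {ω : LinearMap.BilinForm ℂ V} {ε : ℂ}

/-- A reflection or symplectic transvection which maps `a` to `b`. -/
theorem IsForm.exists_move (hω : IsForm T ω ε) {a b : V} (ha : ω a a = 0) (hb : ω b b = 0)
    (hab : ω a b ≠ 0) : ∃ g ∈ T.G, g a = b ∧ (∀ x, ω a x = 0 → ω b x = 0 → g x = x) ∧
      ∀ K : Submodule ℂ V, a ∈ K → b ∈ K → K.map g.toLinearMap ≤ K := by
  have hba : ω b a ≠ 0 := hω.ne_zero_comm.1 hab
  have hε := hω.eps_ne_zero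
  have hεε := hω.eps
  have hab' := hω.symm a b
  -- Normalized so that `φ a = 1`, whence `1 + φ ⊗ (b - a)` sends `a` to `b`.
  set φ : Dual ℂ V := (ω b a)⁻¹ • ω (b - a) with hφdef
  have hφ : φ ∈ T.Vstar := T.Vstar.smul_mem _ (hω.mem_vstar _)
  have hφx : ∀ x, φ x = (ω b a)⁻¹ * (ω b x - ω a x) := fun x => by simp [hφdef]
  -- This is the determinant: `-1` for a reflection, `1` for a transvection.
  have hφu : 1 + φ (b - a) = -ε := by
    rw [hφx]
    simp only [map_sub, ha, hb, hab']
    field_simp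
    ring
  obtain ⟨g, hg, hgx, -⟩ := exists_rankOne hφ (b - a) (by rw [hφu]; exact neg_ne_zero.2 hε)
  refine ⟨g, hω.mem_G_iff.2 ⟨hg, fun x y => ?_⟩, ?_, fun x hax hbx => ?_, ?_⟩
  · rw [hgx, hgx, hφx, hφx]
    simp only [map_sub, map_add, map_smul, LinearMap.sub_apply, LinearMap.add_apply,
      LinearMap.smul_apply, ha, hb, hab', hω.symm x b, hω.symm x a, smul_eq_mul]
    field_simp
    ring
  · rw [hgx, hφx, ha, sub_zero, inv_mul_cancel₀ hba, one_smul]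
    abel
  · rw [hgx, hφx, hax, hbx]
    simp
  · rintro K haK hbK _ ⟨x, hx, rfl⟩
    change g x ∈ K
    rw [hgx]
    exact add_mem hx (K.smul_mem _ (sub_mem hbK haK))

/-- Covers the case of orthogonal `a` and `b`: move `a` to `d` and then `d` to `b`, through an
isotropic `d` orthogonal to neither. -/
theorem IsForm.exists_move_via (hω : IsForm T ω ε) {a b d : V} (ha : ω a a = 0) (hb : ω b b = 0)
    (hd : ω d d = 0) (had : ω a d ≠ 0) (hdb : ω d b ≠ 0) :
    ∃ g ∈ T.G, g a = b ∧ (∀ x, ω a x = 0 → ω b x = 0 → ω d x = 0 → g x = x) ∧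
      ∀ K : Submodule ℂ V, a ∈ K → b ∈ K → d ∈ K → K.map g.toLinearMap ≤ K := by
  obtain ⟨g, hg, hga, hgx, hgK⟩ := hω.exists_move ha hd had
  obtain ⟨h, hh, hhd, hhx, hhK⟩ := hω.exists_move hd hb hdb
  refine ⟨h * g, mul_mem hh hg, ?_, fun x hax hbx hdx => ?_, ?_⟩
  · change h (g a) = b
    rw [hga, hhd]
  · change h (g x) = x
    rw [hgx x hax hdx, hhx x hdx hbx]
  · rintro K haK hbK hdK _ ⟨x, hx, rfl⟩
    exact hhK K hdK hbK ⟨g x, hgK K haK hdK ⟨x, hx, rfl⟩, rfl⟩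

end Form

theorem ClassicalType.mem_G_A {Vs : Submodule ℂ (Dual ℂ V)} {h1 h2} {g : V ≃ₗ[ℂ] V}
    (hg : g ∈ GLInf Vs) : g ∈ (ClassicalType.A Vs h1 h2).G :=
  ⟨hg, fun ω hω => by simp [ClassicalType.form] at hω⟩

/-- In type (A), a move from `a` to `b` along a linear form. -/
theorem ClassicalType.exists_move_A {Vs : Submodule ℂ (Dual ℂ V)} {h1 h2} {φ : Dual ℂ V}
    (hφ : φ ∈ Vs) {a b : V} (ha : φ a = 1) (hb : φ b ≠ 0) :
    ∃ g ∈ (ClassicalType.A Vs h1 h2).G, g a = b ∧ (∀ x, φ x = 0 → g x = x) ∧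
      ∀ K : Submodule ℂ V, a ∈ K → b ∈ K → K.map g.toLinearMap ≤ K := by
  obtain ⟨g, hg, hgx, -⟩ := exists_rankOne hφ (b - a) (by simpa [ha] using hb)
  refine ⟨g, ClassicalType.mem_G_A hg, ?_, fun x hx => ?_, ?_⟩
  · rw [hgx, ha, one_smul]
    abel
  · rw [hgx, hx, zero_smul, add_zero]
  · rintro K haK hbK _ ⟨x, hx, rfl⟩
    change g x ∈ K
    rw [hgx]
    exact add_mem hx (K.smul_mem _ (sub_mem hbK haK))

/-! ### Subspaces stable by `H(E)` -/

theorem ClassicalType.mem_H_iff {T : ClassicalType V} {E : Set V} {g : V ≃ₗ[ℂ] V} :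
    g ∈ T.H E ↔ g ∈ T.G ∧ ∀ e : E, ∃ c : ℂ, g e = c • (e : V) :=
  ⟨fun h => ⟨h.1, fun e => h.2 e e.2⟩, fun h => ⟨h.1, fun e he => h.2 ⟨e, he⟩⟩⟩

theorem IsBasis.coord_smul_apply {E : Set V} (hE : IsBasis E) (e f : E) :
    ∃ c : ℂ, hE.basis.coord e f • (e : V) = c • (f : V) := by
  by_cases h : f = e
  · subst h
    exact ⟨_, rfl⟩
  · exact ⟨0, by rw [hE.coord_ne h, zero_smul, zero_smul]⟩

/-- `H(E)` contains enough diagonal elements to isolate one coordinate: the differences `h v - v`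
involve only `e`, or only `e` and `i e`. -/
theorem ClassicalType.IsAdmissible.coord_smul_mem {T : ClassicalType V} {E : Set V}
    (hE : T.IsAdmissible E) {F : Submodule ℂ V} (hF : ∀ h ∈ T.H E, F.map h.toLinearMap ≤ F)
    {v : V} (hv : v ∈ F) (e : E) : hE.isBasis.basis.coord e v • (e : V) ∈ F := by
  have hb := hE.isBasis
  have hsub : ∀ h ∈ T.H E, h v - v ∈ F := fun h hh => sub_mem (hF h hh ⟨v, hv, rfl⟩) hv
  rcases T.cases with ⟨Vs, h1, h2, rfl⟩ | ⟨ω, ε, hω⟩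
  · obtain ⟨g, hg, hgx, -⟩ := exists_rankOne (hE.coord_mem e) (e : V)
      (by rw [hb.coord_self]; norm_num)
    have hgH : g ∈ (ClassicalType.A Vs h1 h2).H E := ClassicalType.mem_H_iff.2
      ⟨ClassicalType.mem_G_A hg, fun f => by
      obtain ⟨c, hc⟩ := hb.coord_smul_apply e f
      exact ⟨1 + c, by rw [hgx, hc, add_smul, one_smul]⟩⟩
    have := hsub g hgH
    rwa [hgx, add_sub_cancel_left] at this
  · obtain ⟨-, i, hi, -, hi'⟩ := (hω.admissible_iff E).1 hE
    set α := hb.basis.coord e with hα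
    set β := hb.basis.coord (i e) with hβ
    have hαm : α ∈ T.Vstar := hE.coord_mem e
    have hβm : β ∈ T.Vstar := hE.coord_mem (i e)
    have hae : α e = 1 := hb.coord_self e
    have hbe : β (i e) = 1 := hb.coord_self (i e)
    have hl : ∀ y, ω e y = ω e (i e) * β y := IsForm.apply_left hb hi' e
    have hr : ∀ y, ω y e = ε * ω e (i e) * β y := fun y => by
      rw [hω.symm, hl, mul_assoc]
    have hl' : ∀ y, ω (i e) y = ω (i e) e * α y := fun y => by
      have := IsForm.apply_left hb hi' (i e) y
      rwa [hi e] at this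
    have hc := hω.symm (i e) e
    have hεε := hω.eps
    by_cases hie : i e = e
    · have hαβ : β = α := by rw [hβ, hie]
      -- The reflection which negates the fixed basis vector `e`.
      obtain ⟨g, hg, hgx, -⟩ := exists_rankOne (T.Vstar.smul_mem (-2) hαm) (e : V)
        (by simp [hae]; norm_num)
      have hgx' : ∀ x, g x = x + (-2 * α x) • (e : V) := fun x => by simpa using hgx x
      have hee : ω (e : V) e ≠ 0 := (hi' e e).2 hie.symm
      have hε1 : ε = 1 := hω.self.resolve_right fun h => hee (h _)
      have hgH : g ∈ T.H E := by
        refine ClassicalType.mem_H_iff.2 ⟨hω.mem_G_iff.2 ⟨hg, fun x y => ?_⟩, fun f => ?_⟩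
        · rw [hgx', hgx']
          rw [hie, hαβ] at hl hr
          simp only [map_add, map_smul, LinearMap.add_apply, LinearMap.smul_apply, smul_eq_mul,
            hl y, hr x, hε1]
          ring
        · obtain ⟨c, hc⟩ := hb.coord_smul_apply e f
          exact ⟨1 + -2 * c, by rw [hgx', mul_smul, hc, add_smul, one_smul, mul_smul]⟩
      have := hsub g hgH
      rw [hgx', add_sub_cancel_left, mul_smul] at this
      exact (F.smul_mem_iff (by norm_num)).1 this
    · have hbe0 : β e = 0 := hb.coord_ne (fun h => hie h.symm)
      have hae0 : α (i e) = 0 := hb.coord_ne hie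
      have hee : ω (e : V) e = 0 := not_not.1 (mt (hi' e e).1 fun h => hie h.symm)
      have hii : ω (i e : V) (i e) = 0 := by rw [hl', hae0, mul_zero]
      -- The element multiplying `e` by `t` and `i e` by `s = t⁻¹` preserves `ω`.
      have hdiag : ∀ t s : ℂ, t * s = 1 → (t - 1) • (α v • (e : V)) +
          (s - 1) • (β v • (i e : V)) ∈ F := by
        intro t s hts
        have ht : t ≠ 0 := left_ne_zero_of_mul_eq_one hts
        have hs : s ≠ 0 := right_ne_zero_of_mul_eq_one hts
        obtain ⟨g, hg, hgx, -⟩ := exists_rankOne (T.Vstar.smul_mem (t - 1) hαm) (e : V)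
          (by simpa [hae] using ht)
        obtain ⟨g', hg', hgx', -⟩ := exists_rankOne (T.Vstar.smul_mem (s - 1) hβm) (i e : V)
          (by simpa [hbe] using hs)
        have hgg : ∀ x, (g * g') x = x + (t - 1) • (α x • (e : V)) +
            (s - 1) • (β x • (i e : V)) := by
          intro x
          change g (g' x) = _
          rw [hgx, hgx']
          simp only [LinearMap.smul_apply, map_add, map_smul, smul_eq_mul, hae0, mul_zero, add_zero,
            mul_smul]
          abel
        have hgH : g * g' ∈ T.H E := by
          refine ClassicalType.mem_H_iff.2 ⟨hω.mem_G_iff.2 ⟨mul_mem hg hg', fun x y => ?_⟩, fun f => ?_⟩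
          · rw [hgg, hgg]
            simp only [map_add, map_smul, LinearMap.add_apply, LinearMap.smul_apply, smul_eq_mul,
              hl y, hr x, hl' y, hl' x, hee, hii, hω.symm x (i e), hc]
            linear_combination (ω e (i e)) * (α x * β y + ε * β x * α y) * hts +
              ω e (i e) * β y * α x * (s - 1) * hεε
          · obtain ⟨c, hc⟩ := hb.coord_smul_apply e f
            obtain ⟨d, hd⟩ := hb.coord_smul_apply (i e) f
            exact ⟨1 + (t - 1) * c + (s - 1) * d, by
              rw [hgg, hc, hd, add_smul, add_smul, one_smul, mul_smul, mul_smul]⟩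
        have := hsub _ hgH
        rw [hgg] at this
        convert this using 1
        abel
      have h2 := hdiag 2 (1 / 2) (by norm_num)
      have h3 := hdiag 3 (1 / 3) (by norm_num)
      -- The coefficients of `i e` for `t = 2` and `t = 3` are `-1/2` and `-2/3` times the
      -- coordinate, so the weights 4 and 3 cancel them; `-2` times the wanted vector remains.
      have := sub_mem (F.smul_mem 4 h2) (F.smul_mem 3 h3)
      have h4 : (-2 : ℂ) • (α v • (e : V)) ∈ F := by
        convert this using 1
        module
      exact (F.smul_mem_iff (by norm_num)).1 h4

theorem ClassicalType.IsAdmissible.mem_of_coord_ne_zero {T : ClassicalType V} {E : Set V}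
    (hE : T.IsAdmissible E) {F : Submodule ℂ V} (hF : ∀ h ∈ T.H E, F.map h.toLinearMap ≤ F)
    {v : V} (hv : v ∈ F) {e : E} (he : hE.isBasis.basis.coord e v ≠ 0) : (e : V) ∈ F :=
  (F.smul_mem_iff he).1 (hE.coord_smul_mem hF hv e)

theorem ClassicalType.IsAdmissible.eq_span {T : ClassicalType V} {E : Set V}
    (hE : T.IsAdmissible E) {F : Submodule ℂ V} (hF : ∀ h ∈ T.H E, F.map h.toLinearMap ≤ F) :
    F = Submodule.span ℂ (E ∩ F) := by
  apply le_antisymm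
  · intro v hv
    rw [hE.isBasis.mem_span_iff Set.inter_subset_left]
    exact fun e he => ⟨e.2, hE.mem_of_coord_ne_zero hF hv he⟩
  · exact Submodule.span_le.2 Set.inter_subset_right

/-! ### Exchanging basis vectors -/

/-- Almost all elements of an admissible basis can be exchanged by elements of `G` which stabilize
the coordinate subspaces containing almost all or almost no basis vector, uniformly. -/
theorem ClassicalType.IsAdmissible.exists_exchange {T : ClassicalType V} {E : Set V}
    (hE : T.IsAdmissible E) {Z : Set V} (hZ : Z.Finite) :
    ∃ Z' : Set V, Z'.Finite ∧ Z ⊆ Z' ∧ ∀ e ∈ E \ Z', ∀ f ∈ E \ Z', ∃ g ∈ T.G, g e = f ∧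
      ∀ S ⊆ E, (E \ Z ⊆ S ∨ S ⊆ Z) →
        (Submodule.span ℂ S).map g.toLinearMap = Submodule.span ℂ S := by
  have hb := hE.isBasis
  have main : ∃ Z' : Set V, Z'.Finite ∧ Z ⊆ Z' ∧ ∀ e ∈ E \ Z', ∀ f ∈ E \ Z', e ≠ f →
      ∃ g ∈ T.G, g e = f ∧ (∀ x ∈ E ∩ Z, g x = x) ∧
        ∀ K : Submodule ℂ V, E \ Z ⊆ K → K.map g.toLinearMap ≤ K := by
    rcases T.cases with ⟨Vs, h1, h2, rfl⟩ | ⟨ω, ε, hω⟩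
    · refine ⟨Z, hZ, subset_rfl, fun e he f hf hef => ?_⟩
      have hef' : (⟨e, he.1⟩ : E) ≠ ⟨f, hf.1⟩ := fun h => hef (congrArg Subtype.val h)
      have hee := hb.coord_self ⟨e, he.1⟩
      have hff := hb.coord_self ⟨f, hf.1⟩
      have h0 := hb.coord_ne hef'
      have h0' := hb.coord_ne hef'.symm
      -- The form `e^* + f^*` takes the value 1 at both `e` and `f` and vanishes on the rest of `E`.
      obtain ⟨g, hg, hge, hgx, hgK⟩ := ClassicalType.exists_move_A (h1 := h1) (h2 := h2)
        (add_mem (hE.coord_mem ⟨e, he.1⟩) (hE.coord_mem ⟨f, hf.1⟩)) (a := e) (b := f)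
        (by rw [LinearMap.add_apply]; exact (congrArg₂ (· + ·) hee h0).trans (add_zero 1))
        (by
          rw [LinearMap.add_apply]
          exact ((congrArg₂ (· + ·) h0' hff).trans (zero_add 1)).trans_ne one_ne_zero)
      refine ⟨g, hg, hge, fun x hx => hgx x ?_, fun K hK => hgK K (hK he) (hK hf)⟩
      rw [LinearMap.add_apply]
      have hx1 := hb.coord_ne (e := ⟨e, he.1⟩) (f := ⟨x, hx.1⟩)
        (fun h => he.2 (Subtype.mk.inj h ▸ hx.2))
      have hx2 := hb.coord_ne (e := ⟨f, hf.1⟩) (f := ⟨x, hx.1⟩)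
        (fun h => hf.2 (Subtype.mk.inj h ▸ hx.2))
      exact (congrArg₂ (· + ·) hx1 hx2).trans (add_zero 0)
    · obtain ⟨-, i, hi, hfix, hi'⟩ := (hω.admissible_iff E).1 hE
      have hi0 : ∀ e e' : E, e' ≠ i e → ω (e : V) (e' : V) = 0 := fun e e' h =>
        not_not.1 (mt (hi' e e').1 h)
      have hZE : {e : E | (e : V) ∈ Z}.Finite := hZ.preimage Subtype.val_injective.injOn
      -- Besides `Z`, its image under `i` and the possible fixed point are removed: then `e`, `f`
      -- and their partners avoid `Z` and are isotropic.
      refine ⟨Z ∪ Subtype.val '' (i '' {e : E | (e : V) ∈ Z}) ∪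
        Subtype.val '' (Function.fixedPoints i), (hZ.union ((hZE.image _).image _)).union
        (hfix.finite.image _), fun z hz => Or.inl (Or.inl hz), ?_⟩
      rintro e ⟨he, he'⟩ f ⟨hf, hf'⟩ hef
      lift e to E using he
      lift f to E using hf
      have hne : e ≠ f := fun h => hef (congrArg Subtype.val h)
      simp only [Set.mem_union, not_or] at he' hf'
      have heZ := he'.1.1
      have hfZ := hf'.1.1
      have hieZ : (i e : V) ∉ Z := fun h => he'.1.2 ⟨e, ⟨i e, h, hi e⟩, rfl⟩
      have hifZ : (i f : V) ∉ Z := fun h => hf'.1.2 ⟨f, ⟨i f, h, hi f⟩, rfl⟩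
      have hie : e ≠ i e := fun h => he'.2 ⟨e, h.symm, rfl⟩
      have hif : f ≠ i f := fun h => hf'.2 ⟨f, h.symm, rfl⟩
      have hz : ∀ d : E, (i d : V) ∉ Z → ∀ x ∈ E ∩ Z, ω (d : V) x = 0 := by
        rintro d hd x ⟨hxE, hxZ⟩
        exact hi0 d ⟨x, hxE⟩ fun h => hd (congrArg Subtype.val h ▸ hxZ)
      by_cases hfe : f = i e
      · obtain ⟨g, hg, hge, hgx, hgK⟩ := hω.exists_move (hi0 e e hie) (hi0 f f hif)
          ((hi' e f).2 hfe)
        exact ⟨g, hg, hge, fun x hx => hgx x (hz e hieZ x hx) (hz f hifZ x hx),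
          fun K hK => hgK K (hK ⟨e.2, heZ⟩) (hK ⟨f.2, hfZ⟩)⟩
      · have hef' : e ≠ i f := fun h => hfe (by rw [h, hi])
        have hii : ∀ x y : E, i x = i y → x = y := fun x y h => hi.injective h
        have hd1 : ω (i e : V) (i e) = 0 := hi0 _ _ (by rw [hi]; exact hie.symm)
        have hd2 : ω (i f : V) (i f) = 0 := hi0 _ _ (by rw [hi]; exact hif.symm)
        have hd3 : ω (i e : V) (i f) = 0 := hi0 _ _ (by rw [hi]; exact hef'.symm)
        have hd4 : ω (i f : V) (i e) = 0 := hi0 _ _ (by rw [hi]; exact fun h => hfe h.symm)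
        have he1 : ω (e : V) (i f) = 0 := hi0 _ _ fun h => hne (hii _ _ h).symm
        have he2 : ω (i e : V) f = 0 := hi0 _ _ (by rw [hi]; exact hne.symm)
        -- Here `e` and `f` are orthogonal; `i e + i f` is isotropic and pairs nontrivially with
        -- both.
        obtain ⟨g, hg, hge, hgx, hgK⟩ := hω.exists_move_via (a := e) (b := f)
          (d := (i e : V) + i f) (hi0 e e hie) (hi0 f f hif)
          (by simp [hd1, hd2, hd3, hd4]) (by
            rw [map_add, he1, add_zero]
            exact (hi' _ _).2 rfl)
          (by
            rw [map_add, LinearMap.add_apply, he2, zero_add]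
            exact (hi' _ _).2 (hi f).symm)
        refine ⟨g, hg, hge, fun x hx => hgx x (hz e hieZ x hx) (hz f hifZ x hx) ?_,
          fun K hK => hgK K (hK ⟨e.2, heZ⟩) (hK ⟨f.2, hfZ⟩)
            (add_mem (hK ⟨(i e).2, hieZ⟩) (hK ⟨(i f).2, hifZ⟩))⟩
        rw [map_add, LinearMap.add_apply, hz (i e) (by rwa [hi]) x hx,
          hz (i f) (by rwa [hi]) x hx, add_zero]
  obtain ⟨Z', hZ', hZZ', h⟩ := main
  refine ⟨Z', hZ', hZZ', fun e he f hf => ?_⟩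
  by_cases hef : e = f
  · exact ⟨1, one_mem _, hef, fun S _ _ => Submodule.map_id _⟩
  · obtain ⟨g, hg, hge, hgx, hgK⟩ := h e he f hf hef
    refine ⟨g, hg, hge, fun S hSE hS => GLInf.map_eq_of_map_le hg.1 ?_⟩
    rcases hS with hS | hS
    · exact hgK _ (hS.trans Submodule.subset_span)
    · rw [Submodule.map_span, Submodule.span_le]
      rintro _ ⟨x, hx, rfl⟩
      have : g x = x := hgx x ⟨hSE hx, hS hx⟩
      rw [SetLike.mem_coe]
      exact (congrArg (· ∈ Submodule.span ℂ S) this).mpr (Submodule.subset_span hx)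

/-! ### Large parabolic subgroups -/

/-- Every member of `𝓕` contains almost all or almost no elements of `E`, uniformly. -/
def IsNearlyTrivial (E : Set V) (𝓕 : Set (Submodule ℂ V)) : Prop :=
  ∃ Z : Set V, Z.Finite ∧ ∀ F ∈ 𝓕, E \ Z ⊆ F ∨ E ∩ F ⊆ Z

theorem ClassicalType.map_le_of_H_le_Stab {T : ClassicalType V} {𝓕 : Set (Submodule ℂ V)}
    (h𝓕 : ∀ F ∈ 𝓕, ∀ K ∈ 𝓕, F ≤ K ∨ K ≤ F) {E : Set V} (hH : T.H E ≤ T.Stab 𝓕)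
    {F : Submodule ℂ V} (hF : F ∈ 𝓕) : ∀ h ∈ T.H E, F.map h.toLinearMap ≤ F :=
  fun _ hh => (((ClassicalType.mem_Stab_iff h𝓕).1 (hH hh)).2 F hF).le

theorem IsBasis.finite_inter {E : Set V} (hE : IsBasis E) (F : Submodule ℂ V)
    [FiniteDimensional ℂ F] : (E ∩ F).Finite := by
  have h : LinearIndependent ℂ fun e : (E ∩ F : Set V) => (⟨e, e.2.2⟩ : F) := by
    have : LinearIndependent ℂ (fun e : (E ∩ F : Set V) => (e : V)) :=
      hE.1.mono Set.inter_subset_left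
    exact LinearIndependent.of_comp F.subtype this
  have := h.finite
  exact Set.toFinite _

/-- Since `F` is a coordinate subspace, the basis vectors outside `F` stay independent modulo `F`.
-/
theorem ClassicalType.IsAdmissible.finite_diff {T : ClassicalType V} {E : Set V}
    (hE : T.IsAdmissible E) {F : Submodule ℂ V} (hF : ∀ h ∈ T.H E, F.map h.toLinearMap ≤ F)
    [FiniteDimensional ℂ (V ⧸ F)] : (E \ F).Finite := by
  have h0 : LinearIndependent ℂ (fun e : (E \ F : Set V) => (e : V)) :=
      hE.isBasis.1.mono Set.sdiff_subset
  have h : LinearIndependent ℂ fun e : (E \ F : Set V) => F.mkQ e := by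
    refine h0.map ?_
    rw [Submodule.ker_mkQ, Subtype.range_coe, disjoint_iff, eq_bot_iff]
    rintro v ⟨h1, h2⟩
    rw [SetLike.mem_coe, hE.isBasis.mem_span_iff Set.sdiff_subset] at h1
    refine hE.isBasis.basis.ext_elem fun e => ?_
    by_contra h
    have h : hE.isBasis.basis.coord e v ≠ 0 := by simpa using h
    exact (h1 e h).2 (hE.mem_of_coord_ne_zero hF h2 h)
  have := h.finite
  exact Set.toFinite _

theorem IsBasis.finiteDimensional_quotient {E : Set V} (hE : IsBasis E) {Z : Set V}
    (hZ : Z.Finite) {F : Submodule ℂ V} (h : E \ Z ⊆ F) : FiniteDimensional ℂ (V ⧸ F) := by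
  refine ⟨⟨(hZ.image F.mkQ).toFinset, ?_⟩⟩
  rw [Set.Finite.coe_toFinset, eq_top_iff, ← F.range_mkQ, LinearMap.range_eq_map, ← hE.2,
    Submodule.map_span, Submodule.span_le]
  rintro _ ⟨e, he, rfl⟩
  by_cases heZ : e ∈ Z
  · exact Submodule.subset_span ⟨e, heZ, rfl⟩
  · have : F.mkQ e = 0 := by simpa using h ⟨he, heZ⟩
    rw [this]
    exact zero_mem _

/-- The chain defining `P` need not be `𝓕`. The link is that the exchanging elements stabilize the
chain, so they lie in `P` and stabilize `𝓕`: a member containing one basis vector outside `Z'`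
contains all of them. -/
theorem ClassicalType.IsLarge.isNearlyTrivial {T : ClassicalType V} {𝓕 : Set (Submodule ℂ V)}
    (h𝓕 : ∀ F ∈ 𝓕, ∀ K ∈ 𝓕, F ≤ K ∨ K ≤ F) {E : Set V} (hE : T.IsAdmissible E)
    (hH : T.H E ≤ T.Stab 𝓕) (h : T.IsLarge (T.Stab 𝓕)) : IsNearlyTrivial E 𝓕 := by
  obtain ⟨-, m, K, hK, hfin⟩ := h
  have hKH : ∀ k, ∀ h ∈ T.H E, (K k).map h.toLinearMap ≤ K k := fun k h hh =>
    (((hK.mem_iff h).1 (hH hh)).2 k).le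
  have hex : ∀ k, ∃ Z : Set V, Z.Finite ∧ (E \ Z ⊆ K k ∨ E ∩ K k ⊆ Z) := by
    intro k
    rcases hfin k with h | h
    · exact ⟨E ∩ K k, hE.isBasis.finite_inter _, Or.inr subset_rfl⟩
    · refine ⟨E \ K k, hE.finite_diff (hKH k), Or.inl ?_⟩
      rw [Set.sdiff_sdiff_right_self]
      exact Set.inter_subset_right
  choose Z hZ hZK using hex
  obtain ⟨Z', hZ', -, hex⟩ := hE.exists_exchange (Set.finite_iUnion hZ)
  refine ⟨Z', hZ', fun F hF => ?_⟩
  by_contra! hcon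
  obtain ⟨h1, h2⟩ := hcon
  obtain ⟨f, hf, hfF⟩ := Set.not_subset.1 h1
  obtain ⟨e, he, heZ⟩ := Set.not_subset.1 h2
  obtain ⟨g, hg, hge, hgS⟩ := hex e ⟨he.1, heZ⟩ f hf
  have hgP : g ∈ T.Stab 𝓕 := by
    rw [hK.mem_iff]
    refine ⟨hg, fun k => ?_⟩
    have := hgS (E ∩ K k) Set.inter_subset_left ((hZK k).imp
      (fun h x hx => ⟨hx.1, h ⟨hx.1, fun hxZ => hx.2 (Set.mem_iUnion_of_mem k hxZ)⟩⟩)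
      fun h => h.trans (Set.subset_iUnion Z k))
    rwa [← hE.eq_span (hKH k)] at this
  have := ((ClassicalType.mem_Stab_iff h𝓕).1 hgP).2 F hF
  refine hfF ?_
  rw [← this]
  exact ⟨e, he.2, hge⟩

/-- By exchange, an invariant subspace contains all or none of the basis vectors outside a finite
set `Z'`. It is thus determined by this alternative and a subset of `Z'`. -/
theorem IsNearlyTrivial.isSemilarge {T : ClassicalType V} {𝓕 : Set (Submodule ℂ V)}
    (h𝓕 : ∀ F ∈ 𝓕, ∀ K ∈ 𝓕, F ≤ K ∨ K ≤ F) {E : Set V} (hE : T.IsAdmissible E)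
    (hH : T.H E ≤ T.Stab 𝓕) (h : IsNearlyTrivial E 𝓕) : IsSemilarge (T.Stab 𝓕) := by
  obtain ⟨Z, hZ, hZF⟩ := h
  obtain ⟨Z', hZ', hZZ', hex⟩ := hE.exists_exchange hZ
  refine ((hZ'.finite_subsets.image (Submodule.span ℂ)).union
    (hZ'.finite_subsets.image fun R => Submodule.span ℂ ((E \ Z') ∪ R))).subset fun W hW => ?_
  have hWE := hE.eq_span fun h hh => hW h (hH hh)
  by_cases hWZ : E ∩ W ⊆ Z'
  · exact Or.inl ⟨E ∩ W, hWZ, hWE.symm⟩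
  · obtain ⟨e, he, heZ⟩ := Set.not_subset.1 hWZ
    refine Or.inr ⟨E ∩ W ∩ Z', Set.inter_subset_right, ?_⟩
    have hsub : E \ Z' ⊆ W := by
      intro f hf
      obtain ⟨g, hg, hge, hgS⟩ := hex e ⟨he.1, heZ⟩ f hf
      have hgP : g ∈ T.Stab 𝓕 := by
        rw [ClassicalType.mem_Stab_iff h𝓕]
        refine ⟨hg, fun F hF => ?_⟩
        have := hgS (E ∩ F) Set.inter_subset_left ((hZF F hF).imp_left
          (fun h x hx => ⟨hx.1, h hx⟩))
        rwa [← hE.eq_span (ClassicalType.map_le_of_H_le_Stab h𝓕 hH hF)] at this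
      exact hW g hgP ⟨e, he.2, hge⟩
    have heq : (E \ Z') ∪ (E ∩ W ∩ Z') = E ∩ W := by
      ext x
      constructor
      · rintro (hx | hx)
        · exact ⟨hx.1, hsub hx⟩
        · exact hx.1
      · intro hx
        by_cases hxZ : x ∈ Z'
        · exact Or.inr ⟨hx, hxZ⟩
        · exact Or.inl ⟨hx.1, hxZ⟩
    exact (congrArg (Submodule.span ℂ) heq).trans hWE.symm

theorem ClassicalType.IsGeneralizedFlag.bot_mem [Nontrivial V] {T : ClassicalType V}
    {𝓕 : Set (Submodule ℂ V)} (h𝓕 : T.IsGeneralizedFlag 𝓕) (hfin : 𝓕.Finite) : ⊥ ∈ 𝓕 := by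
  obtain ⟨v, hv⟩ := exists_ne (0 : V)
  obtain ⟨F', _, h, -⟩ := h𝓕.separates v hv
  obtain ⟨F, hF⟩ := hfin.exists_minimal ⟨F', h.1⟩
  suffices F = ⊥ from this ▸ hF.1
  rw [Submodule.eq_bot_iff]
  intro x hx
  by_contra hx0
  obtain ⟨K, _, hK, -, hxK⟩ := h𝓕.separates x hx0
  rcases h𝓕.total F hF.1 K hK.1 with h | h
  · exact hxK (h hx)
  · exact hxK (hF.2 hK.1 h hx)

theorem ClassicalType.IsGeneralizedFlag.top_mem [Nontrivial V] {T : ClassicalType V}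
    {𝓕 : Set (Submodule ℂ V)} (h𝓕 : T.IsGeneralizedFlag 𝓕) (hfin : 𝓕.Finite) : ⊤ ∈ 𝓕 := by
  obtain ⟨v, hv⟩ := exists_ne (0 : V)
  obtain ⟨F', _, h, -⟩ := h𝓕.separates v hv
  obtain ⟨F, hF⟩ := hfin.exists_maximal ⟨F', h.1⟩
  suffices F = ⊤ from this ▸ hF.1
  rw [Submodule.eq_top_iff']
  intro x
  by_contra hx
  obtain ⟨_, K, hK, hxK, -⟩ := h𝓕.separates x fun h => hx (h ▸ zero_mem _)
  rcases h𝓕.total F hF.1 K hK.2.1 with h | h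
  · exact hx (hF.2 hK.2.1 h hxK)
  · exact hx (h hxK)

theorem ClassicalType.IsGeneralizedFlag.exists_chain [Nontrivial V] {T : ClassicalType V}
    {𝓕 : Set (Submodule ℂ V)} (h𝓕 : T.IsGeneralizedFlag 𝓕) (hfin : 𝓕.Finite) :
    ∃ (m : ℕ) (F : Fin (m + 1) → Submodule ℂ V), T.IsStabilizerOfChain (T.Stab 𝓕) F ∧
      ∀ k, F k ∈ 𝓕 := by
  classical
  have hbot := h𝓕.bot_mem hfin
  have htop := h𝓕.top_mem hfin
  let : LinearOrder 𝓕 :=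
    { (inferInstance : PartialOrder 𝓕) with
      le_total := fun F K => h𝓕.total F F.2 K K.2
      toDecidableLE := Classical.decRel _ }
  let : Fintype 𝓕 := hfin.fintype
  obtain ⟨m, hm⟩ : ∃ m, Fintype.card 𝓕 = m + 1 :=
    Nat.exists_eq_succ_of_ne_zero (Fintype.card_pos_iff.2 ⟨⟨⊥, hbot⟩⟩).ne'
  let φ : Fin (m + 1) ≃o 𝓕 := monoEquivOfFin 𝓕 hm
  have hle : ∀ j k, j ≤ k ↔ (φ j : Submodule ℂ V) ≤ φ k := fun j k => φ.le_iff_le.symm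
  refine ⟨m, fun k => φ k, ⟨?_, ?_, ?_, ?_, ?_⟩, fun k => (φ k).2⟩
  · exact fun j k h => φ.strictMono h
  · have h : φ (φ.symm ⟨⊥, hbot⟩) = ⟨⊥, hbot⟩ := φ.apply_symm_apply _
    have := (hle 0 (φ.symm ⟨⊥, hbot⟩)).1 (Fin.zero_le _)
    rw [h] at this
    exact le_bot_iff.1 this
  · have h : φ (φ.symm ⟨⊤, htop⟩) = ⟨⊤, htop⟩ := φ.apply_symm_apply _
    have := (hle (φ.symm ⟨⊤, htop⟩) (Fin.last m)).1 (Fin.le_last _)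
    rw [h] at this
    exact top_le_iff.1 this
  · intro ω hω
    let σ : Fin (m + 1) → Fin (m + 1) := fun k =>
      φ.symm ⟨ω.orthogonal (φ k), (h𝓕.isotropic ω hω _ (φ k).2).1⟩
    have hσ : ∀ k, (φ (σ k) : Submodule ℂ V) = ω.orthogonal (φ k) := fun k => by
      simp [σ]
    have hinv : ∀ k, σ (σ k) = k := fun k => by
      apply φ.injective
      apply Subtype.ext
      rw [hσ, hσ, (h𝓕.isotropic ω hω _ (φ k).2).2]
    have hanti : ∀ j k, j ≤ k → σ k ≤ σ j := fun j k h => by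
      rw [hle, hσ, hσ]
      exact LinearMap.BilinForm.orthogonal_le ((hle j k).1 h)
    have hinj : Function.Injective σ := Function.LeftInverse.injective hinv
    have hmono : StrictMono (σ ∘ Fin.rev) := Monotone.strictMono_of_injective
      (fun j k h => hanti _ _ (Fin.rev_le_rev.2 h)) (hinj.comp Fin.rev_injective)
    -- Reversal followed by `F ↦ F^⊥` is an order automorphism of a finite chain, hence trivial.
    have hid : σ ∘ Fin.rev = id := by
      have := Subsingleton.elim
        (hmono.orderIsoOfSurjective _ (Finite.surjective_of_injective hmono.injective))
        (OrderIso.refl _)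
      exact funext fun k => congrArg (fun e : Fin (m + 1) ≃o Fin (m + 1) => e k) this
    intro k
    rw [← hσ]
    have := congrFun hid k.rev
    simp only [Function.comp_apply, Fin.rev_rev, id] at this
    rw [this]
  · intro g
    rw [ClassicalType.mem_Stab_iff h𝓕.total]
    refine and_congr_right fun _ => ⟨fun h k => h _ (φ k).2, fun h F hF => ?_⟩
    have := h (φ.symm ⟨F, hF⟩)
    rwa [φ.apply_symm_apply] at this

theorem IsNearlyTrivial.isLarge [Nontrivial V] {T : ClassicalType V} {𝓕 : Set (Submodule ℂ V)}
    (h𝓕 : T.IsGeneralizedFlag 𝓕) {E : Set V} (hE : T.IsAdmissible E)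
    (hH : T.H E ≤ T.Stab 𝓕) (h : IsNearlyTrivial E 𝓕) : T.IsLarge (T.Stab 𝓕) := by
  have hs := h.isSemilarge h𝓕.total hE hH
  refine ⟨hs, ?_⟩
  -- Members of `𝓕` are invariant under `P`, so semilargeness makes `𝓕` finite.
  obtain ⟨m, F, hF, hmem⟩ := h𝓕.exists_chain (hs.subset fun F hF g hg =>
    (((ClassicalType.mem_Stab_iff h𝓕.total).1 hg).2 F hF).le)
  refine ⟨m, F, hF, fun k => ?_⟩
  obtain ⟨Z, hZ, hZF⟩ := h
  rcases hZF _ (hmem k) with h | h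
  · exact Or.inr (hE.isBasis.finiteDimensional_quotient hZ h)
  · left
    rw [hE.eq_span (ClassicalType.map_le_of_H_le_Stab h𝓕.total hH (hmem k))]
    exact FiniteDimensional.span_of_finite ℂ (hZ.subset h)

/-! ### Moving finite sets of basis vectors into another admissible basis -/

theorem IsBasis.exists_coord_ne_zero {E : Set V} (hE : IsBasis E) {β : Dual ℂ V} {v : V}
    (h : β v ≠ 0) : ∃ e : E, hE.basis.coord e v ≠ 0 ∧ β e ≠ 0 := by
  by_contra! hcon
  refine h ?_
  rw [← hE.basis.linearCombination_repr v, Finsupp.linearCombination_apply, Finsupp.sum, map_sum]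
  refine Finset.sum_eq_zero fun e he => ?_
  rw [map_smul, hE.basis_apply, hcon e (by simpa using he), smul_zero]

theorem ClassicalType.dualAct_mem {T : ClassicalType V} {g : V ≃ₗ[ℂ] V} (hg : g ∈ T.G)
    {φ : Dual ℂ V} (hφ : φ ∈ T.Vstar) : dualAct g φ ∈ T.Vstar := by
  have : dualAct g φ ∈ T.Vstar.map (dualAct g) := ⟨φ, hφ, rfl⟩
  rwa [hg.1.1] at this

/-- If `g` maps the vectors in `S` into `E` and `a ∉ S` is a further basis vector, then some
`e ∈ E` outside of `g S` occurs in the expansion of `g a`. -/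
theorem IsBasis.exists_coord_map_ne_zero {E₀ E : Set V} (hE₀ : IsBasis E₀) (hE : IsBasis E)
    (g : V ≃ₗ[ℂ] V) {S : Set V} (hS : S ⊆ E₀) (a : E₀) (ha : (a : V) ∉ S) :
    ∃ e : E, hE.basis.coord e (g a) ≠ 0 ∧ ∀ s ∈ S, g s ≠ e := by
  obtain ⟨e, he, he'⟩ := hE.exists_coord_ne_zero (β := dualAct g (hE₀.basis.coord a)) (v := g a)
    (by
      rw [dualAct_apply, g.symm_apply_apply, hE₀.coord_self]
      exact one_ne_zero)
  refine ⟨e, he, fun s hs hse => he' ?_⟩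
  rw [dualAct_apply, ← hse, g.symm_apply_apply]
  exact hE₀.coord_ne (f := ⟨s, hS hs⟩) fun h => ha (congrArg Subtype.val h ▸ hs)

/-- One vector at a time: `g a` is moved to some `e ∈ E` outside `g S` along a multiple of `e^*`.
This form vanishes on `g S ⊂ E`, so the vectors already placed stay fixed. -/
theorem ClassicalType.exists_map_mem_A {Vs : Submodule ℂ (Dual ℂ V)} {h1 h2} {E₀ E : Set V}
    (hE₀ : (ClassicalType.A Vs h1 h2).IsAdmissible E₀)
    (hE : (ClassicalType.A Vs h1 h2).IsAdmissible E) {S : Set V} (hS : S.Finite) (hSE : S ⊆ E₀) :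
    ∃ g ∈ (ClassicalType.A Vs h1 h2).G, ∀ s ∈ S, g s ∈ E := by
  induction S, hS using Set.Finite.induction_on with
  | empty => exact ⟨1, one_mem _, by simp⟩
  | @insert a S ha hS ih =>
    obtain ⟨g, hg, hgS⟩ := ih ((Set.subset_insert a S).trans hSE)
    obtain ⟨e, he, heS⟩ := hE₀.isBasis.exists_coord_map_ne_zero hE.isBasis g
      ((Set.subset_insert a S).trans hSE) ⟨a, hSE (Set.mem_insert a S)⟩ ha
    obtain ⟨k, hk, hka, hkx, -⟩ := ClassicalType.exists_move_A (h1 := h1) (h2 := h2)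
      (Vs.smul_mem (hE.isBasis.basis.coord e (g a))⁻¹ (hE.coord_mem e)) (a := g a) (b := e)
      (inv_mul_cancel₀ he) (mul_ne_zero (inv_ne_zero he) (by
        rw [hE.isBasis.coord_self]
        exact one_ne_zero))
    refine ⟨k * g, mul_mem hk hg, ?_⟩
    rintro s (rfl | hs)
    · change k (g s) ∈ E
      rw [hka]
      exact e.2
    · change k (g s) ∈ E
      rw [hkx]
      · exact hgS s hs
      · have := hE.isBasis.coord_ne (e := e) (f := ⟨g s, hgS s hs⟩)
          fun h => heS s hs (congrArg Subtype.val h)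
        rw [LinearMap.smul_apply]
        exact (congrArg ((hE.isBasis.basis.coord e (g a))⁻¹ * ·) this).trans (mul_zero _)

/-- After the vectors, the coordinate forms are placed one by one, with corrections that disturb
neither the vectors nor the forms already placed. -/
theorem ClassicalType.exists_map_mem_and_dualAct_A {Vs : Submodule ℂ (Dual ℂ V)} {h1 h2}
    {E₀ E : Set V} (hE₀ : (ClassicalType.A Vs h1 h2).IsAdmissible E₀)
    (hE : (ClassicalType.A Vs h1 h2).IsAdmissible E) {S : Set V} (hS : S.Finite) (hSE : S ⊆ E₀)
    {R : Set E₀} (hR : R.Finite) (hRS : ∀ r ∈ R, (r : V) ∉ S) :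
    ∃ g ∈ (ClassicalType.A Vs h1 h2).G, (∀ s ∈ S, g s ∈ E) ∧
      ∀ r ∈ R, ∃ e : E, dualAct g (hE₀.isBasis.basis.coord r) = hE.isBasis.basis.coord e := by
  have hb₀ := hE₀.isBasis
  have hb := hE.isBasis
  induction R, hR using Set.Finite.induction_on with
  | empty =>
    obtain ⟨g, hg, h⟩ := ClassicalType.exists_map_mem_A hE₀ hE hS hSE
    exact ⟨g, hg, h, by simp⟩
  | @insert a R ha hR ih =>
    obtain ⟨g, hg, hgS, hgR⟩ := ih fun r hr => hRS r (Set.mem_insert_of_mem a hr)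
    set β := dualAct g (hb₀.basis.coord a) with hβ
    have hβm : β ∈ Vs := ClassicalType.dualAct_mem hg (hE₀.coord_mem a)
    have hβa : β (g a) = 1 := by
      rw [hβ, dualAct_apply, g.symm_apply_apply, hb₀.coord_self]
    -- Both nonvanishings matter: `β e ≠ 0` keeps `e` out of `g S`, and `e^*(g a) ≠ 0` keeps `e^*`
    -- distinct from the forms already placed.
    obtain ⟨e, he, hβe⟩ := hb.exists_coord_ne_zero (β := β) (v := g a)
      (by rw [hβa]; exact one_ne_zero)
    have hee := hb.coord_self e
    -- Chosen so that `β ∘ k = e^*`, that is, `k⁻¹` carries `β` to `e^*`.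
    obtain ⟨k, hk, hkx, -⟩ := exists_rankOne (sub_mem (hE.coord_mem e) hβm) ((β e)⁻¹ • (e : V))
      (by
        rw [map_smul, LinearMap.sub_apply, hee, smul_eq_mul]
        field_simp
        simpa using hβe)
    refine ⟨k⁻¹ * g, mul_mem (inv_mem (ClassicalType.mem_G_A hk)) hg, fun s hs => ?_, ?_⟩
    · have hβs : β (g s) = 0 := by
        rw [hβ, dualAct_apply, g.symm_apply_apply]
        exact hb₀.coord_ne (f := ⟨s, hSE hs⟩) fun h => hRS a (Set.mem_insert a R)
          (congrArg Subtype.val h ▸ hs)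
      have hes : hb.basis.coord e (g s) = 0 :=
        hb.coord_ne (e := e) (f := ⟨g s, hgS s hs⟩) fun h =>
          hβe ((congrArg (fun x : E => β x) h).symm.trans hβs)
      have : k (g s) = g s := by
        rw [hkx, LinearMap.sub_apply, hes, hβs, sub_zero, zero_smul, add_zero]
      have h' : (k⁻¹ * g) s = g s := by
        change k.symm (g s) = g s
        rw [LinearEquiv.symm_apply_eq, this]
      rw [h']
      exact hgS s hs
    · have hdual : ∀ φ : Dual ℂ V, ∀ x, dualAct (k⁻¹ * g) φ x = dualAct g φ (k x) :=
        fun φ x => rfl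
      rintro r (rfl | hr)
      · refine ⟨e, LinearMap.ext fun x => ?_⟩
        rw [hdual, ← hβ, hkx, map_add, map_smul, map_smul, smul_eq_mul, smul_eq_mul,
          inv_mul_cancel₀ hβe, mul_one, LinearMap.sub_apply, add_sub_cancel]
      · obtain ⟨f, hf⟩ := hgR r hr
        refine ⟨f, LinearMap.ext fun x => ?_⟩
        have hfe : e ≠ f := by
          rintro rfl
          refine he ?_
          rw [← hf, dualAct_apply, g.symm_apply_apply]
          exact hb₀.coord_ne fun h => ha (h ▸ hr)
        rw [hdual, hf, hkx, map_add, map_smul, map_smul, hb.coord_ne hfe, smul_zero, smul_zero,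
          add_zero]

/-- As in type (A), one vector at a time, but `g a` is sent to a fresh isotropic `f ∈ E`, not to the
vector `e` occurring in it, which may be the fixed point of `i`. The move goes through a vector `d`
built from `i e`, `f` and `i f`; all vectors involved are orthogonal to those already placed. -/
theorem IsForm.exists_map_mem {T : ClassicalType V} {ω : LinearMap.BilinForm ℂ V} {ε : ℂ}
    (hω : IsForm T ω ε) (hV : Module.rank ℂ V = Cardinal.aleph0) {E₀ E : Set V}
    (hE₀ : T.IsAdmissible E₀) (hE : T.IsAdmissible E) {S : Set V} (hS : S.Finite) (hSE : S ⊆ E₀)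
    (hiso : ∀ s ∈ S, ∀ t ∈ S, ω s t = 0) : ∃ g ∈ T.G, ∀ s ∈ S, g s ∈ E := by
  have hb := hE.isBasis
  obtain ⟨-, i, hi, hfix, hi'⟩ := (hω.admissible_iff E).1 hE
  have hi0 : ∀ e e' : E, e' ≠ i e → ω (e : V) (e' : V) = 0 := fun e e' h =>
    not_not.1 (mt (hi' e e').1 h)
  induction S, hS using Set.Finite.induction_on with
  | empty => exact ⟨1, one_mem _, by simp⟩
  | @insert a S ha hS ih =>
    obtain ⟨g, hg, hgS⟩ := ih ((Set.subset_insert a S).trans hSE)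
      fun s hs t ht => hiso s (Set.mem_insert_of_mem a hs) t (Set.mem_insert_of_mem a ht)
    have hgω := (hω.mem_G_iff.1 hg).2
    obtain ⟨e, he, heS⟩ := hE₀.isBasis.exists_coord_map_ne_zero hb g
      ((Set.subset_insert a S).trans hSE) ⟨a, hSE (Set.mem_insert a S)⟩ ha
    have hve : ω (g a) (i e) ≠ 0 := by
      rw [hω.ne_zero_comm, IsForm.apply_left hb hi', hi e]
      exact mul_ne_zero ((hi' _ _).2 (hi e).symm) he
    have hfin : {x : E | ω (g a) x ≠ 0}.Finite :=
      ((hE.finite_ne_zero (hω.mem_vstar (g a))).preimage Subtype.val_injective.injOn).subset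
        fun x hx => ⟨x.2, hx⟩
    have hQ : {x : E | ∃ s ∈ S, g s = x}.Finite :=
      ((hS.image g).preimage (f := ((↑) : E → V)) Subtype.val_injective.injOn).subset
        fun x hx => hx
    have hinf : Infinite E := Set.infinite_coe_iff.2 (hb.infinite hV)
    -- Only finitely many candidates are excluded: `f` and `i f` must be orthogonal to `g a` and lie
    -- outside `g S`, and `f` must differ from `i f`, `e` and `i e`.
    obtain ⟨f, hf⟩ := ((((((hfix.finite.union hfin).union
      (hfin.preimage hi.injective.injOn)).union hQ).union
      (hQ.preimage hi.injective.injOn)).union (Set.finite_singleton e)).union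
      (Set.finite_singleton (i e))).exists_notMem
    simp only [Set.mem_union, not_or] at hf
    obtain ⟨⟨⟨⟨⟨⟨hfi, hvf⟩, hvif⟩, hfQ⟩, hifQ⟩, hfe⟩, hfie⟩ := hf
    replace hvf : ω (g a) f = 0 := not_not.1 hvf
    replace hvif : ω (g a) (i f) = 0 := not_not.1 hvif
    replace hfe : f ≠ e := hfe
    replace hfie : f ≠ i e := hfie
    replace hfi : f ≠ i f := fun h => hfi h.symm
    have hff : ω (f : V) f = 0 := hi0 f f hfi
    have hfif : ω (f : V) (i f) ≠ 0 := (hi' _ _).2 rfl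
    have hiff : ω (i f : V) f ≠ 0 := hω.ne_zero_comm.1 hfif
    have hif2 : ω (i f : V) (i f) = 0 := hi0 _ _ (by rw [hi]; exact hfi.symm)
    have hief : ω (i e : V) f = 0 := hi0 _ _ (by rw [hi]; exact hfe)
    have hieif : ω (i e : V) (i f) = 0 := hi0 _ _ (by
      rw [hi]
      rintro rfl
      exact hfie (hi f).symm)
    have hfie' : ω (f : V) (i e) = 0 := hω.eq_zero_comm.1 hief
    have hifie : ω (i f : V) (i e) = 0 := hω.eq_zero_comm.1 hieif
    -- `s` makes `d = i e + s f + i f` isotropic; a correction is needed only if `i e` is not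
    -- isotropic.
    obtain ⟨s, hs⟩ : ∃ s : ℂ, ω (i e : V) (i e) + s * (ω (f : V) (i f) + ω (i f : V) f) = 0 := by
      rcases hω.self with h | h
      · have := hω.symm (i f) f
        rw [h, one_mul] at this
        refine ⟨-ω (i e : V) (i e) / (2 * ω (f : V) (i f)), ?_⟩
        rw [this]
        field_simp
        ring
      · refine ⟨0, ?_⟩
        rw [h, zero_mul, zero_add]
    obtain ⟨k, hk, hka, hkx, -⟩ := hω.exists_move_via (a := g a) (b := f)
      (d := (i e : V) + s • (f : V) + i f)
      (by rw [hgω]; exact hiso a (Set.mem_insert a S) a (Set.mem_insert a S)) hff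
      (by
        simp only [map_add, map_smul, LinearMap.add_apply, LinearMap.smul_apply, smul_eq_mul,
          hff, hif2, hief, hieif, hfie', hifie]
        linear_combination hs)
      (by simpa [hvf, hvif] using hve)
      (by simpa [hief, hff] using hiff)
    refine ⟨k * g, mul_mem hk hg, ?_⟩
    rintro s (rfl | hs)
    · change k (g s) ∈ E
      rw [hka]
      exact f.2
    · change k (g s) ∈ E
      have hsE := hgS s hs
      have h1 : ω (f : V) (g s) = 0 := hi0 f ⟨g s, hsE⟩ fun h =>
        hifQ ⟨s, hs, congrArg Subtype.val h⟩
      have h2 : ω (i f : V) (g s) = 0 := hi0 (i f) ⟨g s, hsE⟩ fun h =>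
        hfQ ⟨s, hs, congrArg Subtype.val (h.trans (hi f))⟩
      have h3 : ω (i e : V) (g s) = 0 := hi0 (i e) ⟨g s, hsE⟩ fun h =>
        heS s hs (congrArg Subtype.val (h.trans (hi e)))
      rw [hkx _ _ h1]
      · exact hsE
      · simp [h1, h2, h3]
      · rw [hgω]
        exact hiso a (Set.mem_insert a S) s (Set.mem_insert_of_mem a hs)

/-! ### Compatible flags in the orbit -/

theorem IsBasis.exists_coord_H_apply {T : ClassicalType V} {E : Set V} (hE : IsBasis E)
    {h : V ≃ₗ[ℂ] V} (hh : h ∈ T.H E) (e : E) :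
    ∃ c : ℂ, ∀ x, hE.basis.coord e (h x) = c * hE.basis.coord e x := by
  obtain ⟨c, hc⟩ := hh.2 e e.2
  refine ⟨c, fun x => ?_⟩
  have : hE.basis.coord e ∘ₗ h.toLinearMap = c • hE.basis.coord e := by
    refine hE.ext fun f hf => ?_
    obtain ⟨d, hd⟩ := hh.2 f hf
    change hE.basis.coord e (h f) = c * hE.basis.coord e f
    by_cases hfe : f = e
    · rw [hfe, hc, map_smul, smul_eq_mul]
    · have h0 : hE.basis.coord e f = 0 :=
        hE.coord_ne (f := ⟨f, hf⟩) fun h => hfe (congrArg Subtype.val h)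
      rw [hd, map_smul, h0, smul_zero, mul_zero]
  exact congrArg (fun φ : Dual ℂ V => φ x) this

theorem ClassicalType.map_span_eq_of_mem_H {T : ClassicalType V} {E S : Set V} (hS : S ⊆ E)
    {h : V ≃ₗ[ℂ] V} (hh : h ∈ T.H E) :
    (Submodule.span ℂ S).map h.toLinearMap = Submodule.span ℂ S := by
  refine GLInf.map_eq_of_map_le hh.1.1 ?_
  rw [Submodule.map_span, Submodule.span_le]
  rintro _ ⟨e, he, rfl⟩
  obtain ⟨c, hc⟩ := hh.2 e (hS he)
  exact (congrArg (· ∈ Submodule.span ℂ S) hc).mpr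
    (Submodule.smul_mem _ c (Submodule.subset_span he))

theorem orthogonal_map {ω : LinearMap.BilinForm ℂ V} {g : V ≃ₗ[ℂ] V}
    (hg : ∀ v w, ω (g v) (g w) = ω v w) (F : Submodule ℂ V) :
    ω.orthogonal (F.map g.toLinearMap) = (ω.orthogonal F).map g.toLinearMap := by
  ext x
  obtain ⟨y, rfl⟩ := g.surjective x
  constructor
  · intro h
    refine ⟨y, fun z hz => ?_, rfl⟩
    have := h (g z) ⟨z, hz, rfl⟩
    exact (hg z y).symm.trans this
  · rintro ⟨y', hy', h⟩ _ ⟨z, hz, rfl⟩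
    rw [← h]
    exact (hg z y').trans (hy' z hz)

/-- Finitely many basis vectors span the small members. The large members are recovered from
finitely many coordinate forms in type (A), and as orthogonals of small members in types (BCD). -/
theorem IsNearlyTrivial.exists_map_compatible {T : ClassicalType V}
    (hV : Module.rank ℂ V = Cardinal.aleph0)
    {𝓕 : Set (Submodule ℂ V)} (h𝓕 : T.IsGeneralizedFlag 𝓕) {E₀ : Set V}
    (hE₀ : T.IsAdmissible E₀) (hH : T.H E₀ ≤ T.Stab 𝓕) (hJ : IsNearlyTrivial E₀ 𝓕) {E : Set V}
    (hE : T.IsAdmissible E) : ∃ g ∈ T.G, ∀ F ∈ 𝓕, ∀ h ∈ T.H E,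
      (F.map g.toLinearMap).map h.toLinearMap = F.map g.toLinearMap := by
  obtain ⟨Z, hZ, hZF⟩ := hJ
  have hb₀ := hE₀.isBasis
  have hinf := hb₀.infinite hV
  have hFH : ∀ F ∈ 𝓕, ∀ h ∈ T.H E₀, F.map h.toLinearMap ≤ F := fun F hF =>
    ClassicalType.map_le_of_H_le_Stab h𝓕.total hH hF
  set S : Set V := {e ∈ E₀ | ∃ F ∈ 𝓕, E₀ ∩ F ⊆ Z ∧ e ∈ F} with hS
  have hSZ : S ⊆ Z := fun e ⟨he, F, hF, h, heF⟩ => h ⟨he, heF⟩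
  have hSE : S ⊆ E₀ := fun e he => he.1
  have hsmall : ∀ g : V ≃ₗ[ℂ] V, (∀ s ∈ S, g s ∈ E) → ∀ F ∈ 𝓕, E₀ ∩ F ⊆ Z → ∀ h ∈ T.H E,
      (F.map g.toLinearMap).map h.toLinearMap = F.map g.toLinearMap := by
    intro g hgS F hF hFZ h hh
    rw [hE₀.eq_span (hFH F hF), Submodule.map_span]
    refine ClassicalType.map_span_eq_of_mem_H ?_ hh
    rintro _ ⟨e, he, rfl⟩
    exact hgS e ⟨he.1, F, hF, hFZ, he.2⟩
  rcases T.cases with ⟨Vs, h1, h2, rfl⟩ | ⟨ω, ε, hω⟩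
  · set R : Set E₀ := {e | ∃ F ∈ 𝓕, E₀ \ Z ⊆ F ∧ (e : V) ∉ F} with hR
    have hRZ : R.Finite := (hZ.preimage Subtype.val_injective.injOn).subset
      fun e ⟨F, hF, h, heF⟩ => by
        by_contra heZ
        exact heF (h ⟨e.2, heZ⟩)
    obtain ⟨g, hg, hgS, hgR⟩ := ClassicalType.exists_map_mem_and_dualAct_A hE₀ hE
      (hZ.subset hSZ) hSE hRZ (by
        -- A large `F` cannot lie in a small `K` because `E₀` is infinite, so `K ≤ F` by total
        -- order.
        rintro e ⟨F, hF, hFZ, heF⟩ ⟨-, K, hK, hKZ, heK⟩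
        obtain ⟨f, hf, hfZ⟩ := hinf.exists_notMem_finite hZ
        rcases h𝓕.total F hF K hK with h | h
        · exact hfZ (hKZ ⟨hf, h (hFZ ⟨hf, hfZ⟩)⟩)
        · exact heF (h heK))
    refine ⟨g, hg, fun F hF h hh => ?_⟩
    rcases hZF F hF with hFZ | hFZ
    · refine GLInf.map_eq_of_map_le hh.1.1 ?_
      rintro _ ⟨x, ⟨y, hy, rfl⟩, rfl⟩
      refine ⟨g.symm (h (g y)), ?_, g.apply_symm_apply _⟩
      rw [hE₀.eq_span (hFH F hF), SetLike.mem_coe, hb₀.mem_span_iff Set.inter_subset_left]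
      intro e he
      refine ⟨e.2, ?_⟩
      by_contra heF
      obtain ⟨f, hf⟩ := hgR e ⟨F, hF, hFZ, heF⟩
      obtain ⟨c, hc⟩ := hE.isBasis.exists_coord_H_apply hh f
      refine he ?_
      rw [← dualAct_apply, hf, hc, ← hf, dualAct_apply, g.symm_apply_apply]
      by_contra hne
      exact heF (hE₀.mem_of_coord_ne_zero (hFH F hF) hy (right_ne_zero_of_mul hne))
    · exact hsmall g hgS F hF hFZ h hh
  · obtain ⟨-, i, hi, -, hi'⟩ := (hω.admissible_iff E₀).1 hE₀
    have hinf' : Infinite E₀ := Set.infinite_coe_iff.2 hinf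
    -- A basis vector `e` such that neither `e` nor `i e` is in `Z`. It is orthogonal to every small
    -- member without lying in it, which excludes `F^⊥ ≤ F`.
    obtain ⟨e, he⟩ := (((hZ.preimage (f := ((↑) : E₀ → V)) Subtype.val_injective.injOn)).union
      ((hZ.preimage (f := ((↑) : E₀ → V)) Subtype.val_injective.injOn).preimage
        hi.injective.injOn)).exists_notMem
    simp only [Set.mem_union, not_or, Set.mem_preimage] at he
    obtain ⟨heZ, hieZ⟩ := he
    have hform : ω ∈ T.form := hω.form
    have hiso : ∀ F ∈ 𝓕, E₀ ∩ F ⊆ Z → F ≤ ω.orthogonal F := by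
      intro F hF hFZ
      refine (h𝓕.total _ hF _ (h𝓕.isotropic ω hform F hF).1).resolve_right fun h => ?_
      refine heZ (hFZ ⟨e.2, h ?_⟩)
      intro y hy
      change ω y e = 0
      rw [hω.eq_zero_comm, IsForm.apply_left hb₀ hi']
      by_contra hne
      exact hieZ (hFZ ⟨(i e).2, hE₀.mem_of_coord_ne_zero (hFH F hF) hy (right_ne_zero_of_mul hne)⟩)
    obtain ⟨g, hg, hgS⟩ := hω.exists_map_mem hV hE₀ hE (hZ.subset hSZ) hSE (by
      rintro s ⟨-, F, hF, hFZ, hsF⟩ t ⟨-, K, hK, hKZ, htK⟩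
      rcases h𝓕.total F hF K hK with h | h
      · exact hiso K hK hKZ htK s (h hsF)
      · exact hiso F hF hFZ (h htK) s hsF)
    refine ⟨g, hg, fun F hF h hh => ?_⟩
    rcases hZF F hF with hFZ | hFZ
    · obtain ⟨hF', hFF⟩ := h𝓕.isotropic ω hform F hF
      -- Otherwise `e ∈ F^⊥`, although `i e ∈ F`.
      have hF'Z : E₀ ∩ ω.orthogonal F ⊆ Z := by
        refine (hZF _ hF').resolve_left fun h => ?_
        have := h ⟨e.2, heZ⟩ (i e) (hFZ ⟨(i e).2, hieZ⟩)
        exact (hi' (i e) e).2 (hi e).symm this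
      rw [← hFF, ← orthogonal_map (hω.mem_G_iff.1 hg).2, ← orthogonal_map (hω.mem_G_iff.1 hh.1).2,
        hsmall g hgS _ hF' hF'Z h hh]
    · exact hsmall g hgS F hF hFZ h hh

/-! ### Transport of admissible bases -/

theorem IsBasis.image {E : Set V} (hE : IsBasis E) (g : V ≃ₗ[ℂ] V) : IsBasis (g '' E) := by
  have := isBasis_range (hE.basis.map g)
  convert this using 1
  ext x
  simp

theorem IsBasis.dualFamily_image {E : Set V} (g : V ≃ₗ[ℂ] V) :
    dualFamily (g '' E) = dualAct g '' dualFamily E := by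
  ext φ
  constructor
  · rintro ⟨_, ⟨e, he, rfl⟩, h1, h0⟩
    refine ⟨φ ∘ₗ g.toLinearMap, ⟨e, he, h1, fun f hf hfe => ?_⟩, ?_⟩
    · exact h0 (g f) ⟨f, hf, rfl⟩ fun h => hfe (g.injective h)
    · ext x
      simp
  · rintro ⟨ψ, ⟨e, he, h1, h0⟩, rfl⟩
    refine ⟨g e, ⟨e, he, rfl⟩, by simpa using h1, ?_⟩
    rintro _ ⟨f, hf, rfl⟩ hfe
    simpa using h0 f hf fun h => hfe (congrArg g h)

theorem IsForm.isAdmissible_image {T : ClassicalType V} {ω : LinearMap.BilinForm ℂ V} {ε : ℂ}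
    (hω : IsForm T ω ε) {E : Set V} (hE : T.IsAdmissible E) {g : V ≃ₗ[ℂ] V}
    (hg : ∀ v w, ω (g v) (g w) = ω v w) : T.IsAdmissible (g '' E) := by
  obtain ⟨hb, i, hi, hfix, hi'⟩ := (hω.admissible_iff E).1 hE
  rw [hω.admissible_iff]
  let σ : E ≃ (g '' E) := g.toEquiv.image E
  have hσ : ∀ e : E, ((σ e : g '' E) : V) = g e := fun e => rfl
  refine ⟨hb.image g, σ ∘ i ∘ σ.symm, fun x => by simp [hi _], ?_, ?_⟩
  · intro x hx y hy
    have hx' : i (σ.symm x) = σ.symm x := by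
      rw [σ.eq_symm_apply]
      exact hx
    have hy' : i (σ.symm y) = σ.symm y := by
      rw [σ.eq_symm_apply]
      exact hy
    exact σ.symm.injective (hfix hx' hy')
  · intro x y
    obtain ⟨e, rfl⟩ := σ.surjective x
    obtain ⟨f, rfl⟩ := σ.surjective y
    rw [hσ, hσ, hg, hi']
    simp

theorem ClassicalType.isAdmissible_image_A {Vs : Submodule ℂ (Dual ℂ V)} {h1 h2} {E : Set V}
    (hE : (ClassicalType.A Vs h1 h2).IsAdmissible E) {g : V ≃ₗ[ℂ] V}
    (hg : Vs.map (dualAct g) = Vs) : (ClassicalType.A Vs h1 h2).IsAdmissible (g '' E) := by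
  refine ⟨hE.isBasis.image g, ?_⟩
  have h : Submodule.span ℂ (dualFamily E) = Vs := hE.2
  change Submodule.span ℂ (dualFamily (g '' E)) = Vs
  rw [IsBasis.dualFamily_image, ← Submodule.map_span, h, hg]

theorem ClassicalType.IsAdmissible.image {T : ClassicalType V} {E : Set V}
    (hE : T.IsAdmissible E) {g : V ≃ₗ[ℂ] V} (hg : g ∈ T.G) : T.IsAdmissible (g '' E) := by
  rcases T.cases with ⟨Vs, h1, h2, rfl⟩ | ⟨ω, ε, hω⟩
  · exact ClassicalType.isAdmissible_image_A hE hg.1.1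
  · exact hω.isAdmissible_image hE (hω.mem_G_iff.1 hg).2

theorem ClassicalType.conj_mem_H {T : ClassicalType V} {E : Set V} {g h : V ≃ₗ[ℂ] V}
    (hg : g ∈ T.G) (hh : h ∈ T.H (⇑(g⁻¹ : V ≃ₗ[ℂ] V) '' E)) : g * h * g⁻¹ ∈ T.H E := by
  refine ⟨mul_mem (mul_mem hg hh.1) (inv_mem hg), fun e he => ?_⟩
  obtain ⟨c, hc⟩ := hh.2 (g⁻¹ e) ⟨e, he, rfl⟩
  refine ⟨c, ?_⟩
  change g (h (g⁻¹ e)) = c • e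
  rw [hc, map_smul]
  exact congrArg (c • ·) (g.apply_symm_apply e)

theorem flagMap_eq_iff {g : V ≃ₗ[ℂ] V} {𝓕 𝓖 : Set (Submodule ℂ V)} :
    flagMap g 𝓕 = 𝓖 ↔ 𝓕 = flagMap g⁻¹ 𝓖 := by
  constructor
  · rintro rfl
    rw [← flagMap_mul, inv_mul_cancel, flagMap_one]
  · rintro rfl
    rw [← flagMap_mul, mul_inv_cancel, flagMap_one]

/-- `g 𝓕` is fixed by `h` if and only if `𝓕` is fixed by `g⁻¹ h g`. -/
theorem flagMap_flagMap_eq_iff {g h : V ≃ₗ[ℂ] V} {𝓕 : Set (Submodule ℂ V)} :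
    flagMap h (flagMap g 𝓕) = flagMap g 𝓕 ↔ flagMap (g⁻¹ * h * g) 𝓕 = 𝓕 := by
  rw [mul_assoc, flagMap_mul, flagMap_mul, eq_comm, flagMap_eq_iff, eq_comm]

/-- The basis `g⁻¹ E` works: `g⁻¹` moves only finitely many elements of `E`. -/
theorem ClassicalType.IsCompatible.isWeaklyCompatible {T : ClassicalType V} {E : Set V}
    (hE : T.IsAdmissible E) {𝓕 : Set (Submodule ℂ V)} {g : V ≃ₗ[ℂ] V} (hg : g ∈ T.G)
    (h : T.IsCompatible E (flagMap g 𝓕)) : T.IsWeaklyCompatible E 𝓕 := by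
  have hfin := hE.finite_not_fixed (inv_mem hg)
  refine ⟨⇑(g⁻¹ : V ≃ₗ[ℂ] V) '' E, hE.image (inv_mem hg), ?_, ?_, fun k hk => ?_⟩
  · refine (hfin.image ⇑(g⁻¹ : V ≃ₗ[ℂ] V)).subset ?_
    rintro _ ⟨⟨e, he, rfl⟩, hge⟩
    exact ⟨e, ⟨he, fun h => hge (h.symm ▸ he)⟩, rfl⟩
  · refine hfin.subset ?_
    rintro e ⟨he, hge⟩
    exact ⟨he, fun h => hge ⟨e, he, h⟩⟩
  · have := h _ (ClassicalType.conj_mem_H hg hk)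
    rw [flagMap_flagMap_eq_iff] at this
    rwa [show g⁻¹ * (g * k * g⁻¹) * g = k by group] at this

/-! ### Bases with which a flag is not weakly compatible -/

/-- If `𝓕` is not nearly trivial, there are infinitely many disjoint pairs of elements of `E`
which are separated by `𝓕`. -/
theorem exists_seq_of_not_isNearlyTrivial {E : Set V} (hE : E.Infinite)
    {𝓕 : Set (Submodule ℂ V)} (h : ¬ IsNearlyTrivial E 𝓕) {j : E → E}
    (hj : Function.Involutive j) {C : Set E} (hC : C.Finite) :
    ∃ p : ℕ → E × E, (∀ n, (p n).1 ∉ C ∧ (p n).2 ∉ C ∧ (p n).2 ≠ j (p n).1 ∧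
        ∃ F ∈ 𝓕, ((p n).1 : V) ∈ F ∧ ((p n).2 : V) ∉ F) ∧
      Pairwise fun m n => (p m).1 ≠ (p n).1 ∧ (p m).1 ≠ (p n).2 ∧ (p m).2 ≠ (p n).1 ∧
        (p m).2 ≠ (p n).2 ∧ (p m).1 ≠ j (p n).1 ∧ (p m).1 ≠ j (p n).2 ∧
        (p m).2 ≠ j (p n).1 ∧ (p m).2 ≠ j (p n).2 := by
  have hinf : Infinite E := Set.infinite_coe_iff.2 hE
  have hj' : ∀ x y, x = j y ↔ y = j x := fun x y => by
    constructor
    · rintro rfl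
      exact (hj y).symm
    · rintro rfl
      exact (hj x).symm
  let P : E × E → Prop := fun p => p.1 ∉ C ∧ p.2 ∉ C ∧ p.2 ≠ j p.1 ∧
    ∃ F ∈ 𝓕, (p.1 : V) ∈ F ∧ (p.2 : V) ∉ F
  have hP : ∀ D : Set E, D.Finite → ∃ p, P p ∧ p.1 ∉ D ∧ p.2 ∉ D := by
    intro D hD
    have hCD := hC.union hD
    simp only [IsNearlyTrivial, not_exists, not_and, not_forall, not_or] at h
    obtain ⟨F, hF, h1, h2⟩ := h _ (hCD.image (Subtype.val))
    obtain ⟨f, ⟨hf, hfD⟩, hfF⟩ := Set.not_subset.1 h1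
    obtain ⟨e, ⟨he, heF⟩, heD⟩ := Set.not_subset.1 h2
    lift f to E using hf
    lift e to E using he
    rw [Subtype.val_injective.mem_set_image, Set.mem_union, not_or] at hfD heD
    -- If the separated pair is matched by `j`, a third vector `x` replaces `e` or `f`, according to
    -- whether `F` contains it.
    by_cases hfe : f = j e
    · obtain ⟨x, hx⟩ := (((hCD.union (Set.finite_singleton f)).union
        (Set.finite_singleton e))).exists_notMem
      simp only [Set.mem_union, not_or, Set.mem_singleton_iff] at hx
      obtain ⟨⟨⟨hxC, hxD⟩, hxf⟩, hxe⟩ := hx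
      by_cases hxF : (x : V) ∈ F
      · exact ⟨(x, f), ⟨hxC, hfD.1, fun h => hxe (hj.injective (h.symm.trans hfe)),
          F, hF, hxF, hfF⟩, hxD, hfD.2⟩
      · exact ⟨(e, x), ⟨heD.1, hxC, fun h => hxf (h.trans hfe.symm), F, hF, heF, hxF⟩, heD.2, hxD⟩
    · exact ⟨(e, f), ⟨heD.1, hfD.1, hfe, F, hF, heF, hfF⟩, heD.2, hfD.2⟩
  let r : E × E → E × E → Prop := fun p q => p.1 ≠ q.1 ∧ p.1 ≠ q.2 ∧ p.2 ≠ q.1 ∧ p.2 ≠ q.2 ∧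
    p.1 ≠ j q.1 ∧ p.1 ≠ j q.2 ∧ p.2 ≠ j q.1 ∧ p.2 ≠ j q.2
  have hr : Std.Symm r := ⟨fun p q ⟨h1, h2, h3, h4, h5, h6, h7, h8⟩ =>
    ⟨h1.symm, h3.symm, h2.symm, h4.symm, fun h => h5 ((hj' _ _).1 h), fun h => h7 ((hj' _ _).1 h),
      fun h => h6 ((hj' _ _).1 h), fun h => h8 ((hj' _ _).1 h)⟩⟩
  obtain ⟨p, hp, hpr⟩ := exists_seq_of_forall_finset_exists' P r (fun s _ => by
    obtain ⟨p, hp, h1, h2⟩ := hP (⋃ q ∈ s, {q.1, q.2, j q.1, j q.2})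
      (s.finite_toSet.biUnion fun q _ => Set.toFinite _)
    refine ⟨p, hp, fun q hq => hr.symm _ _ ?_⟩
    simp only [Set.mem_iUnion, not_exists, Set.mem_insert_iff, Set.mem_singleton_iff, not_or]
      at h1 h2
    obtain ⟨a1, a2, a3, a4⟩ := h1 q hq
    obtain ⟨b1, b2, b3, b4⟩ := h2 q hq
    exact ⟨a1, a2, b1, b2, a3, a4, b3, b4⟩)
  exact ⟨p, hp, hpr⟩

/-- For some `n` both `f n` and `e n + f n` survive in `E'`. Then `e n` has coordinate `-1` at `f
n`, so a compatible subspace containing `e n` contains `f n`. -/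
theorem not_isWeaklyCompatible {T : ClassicalType V} {𝓕 : Set (Submodule ℂ V)}
    (h𝓕 : ∀ F ∈ 𝓕, ∀ K ∈ 𝓕, F ≤ K ∨ K ≤ F) {E : Set V} {e f : ℕ → V} (he : ∀ n, e n ≠ 0)
    (hf : Function.Injective f) (hef : Function.Injective fun n => e n + f n)
    (hfE : ∀ n, f n ∈ E) (hefE : ∀ n, e n + f n ∈ E)
    (hF : ∀ n, ∃ F ∈ 𝓕, e n ∈ F ∧ f n ∉ F) : ¬ T.IsWeaklyCompatible E 𝓕 := by
  rintro ⟨E', hE', -, hfin, hcomp⟩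
  obtain ⟨n, hn⟩ := ((hfin.preimage hf.injOn).union (hfin.preimage hef.injOn)).exists_notMem
  simp only [Set.mem_union, not_or, Set.mem_preimage, Set.mem_sdiff, not_and, not_not] at hn
  have h1 := hn.1 (hfE n)
  have h2 := hn.2 (hefE n)
  obtain ⟨F, hF, heF, hfF⟩ := hF n
  have hH : T.H E' ≤ T.Stab 𝓕 := fun h hh => ⟨hh.1, hcomp h hh⟩
  refine hfF (hE'.mem_of_coord_ne_zero (ClassicalType.map_le_of_H_le_Stab h𝓕 hH hF) heF
    (e := ⟨f n, h1⟩) ?_)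
  have h3 := hE'.isBasis.coord_self ⟨f n, h1⟩
  have h4 : hE'.isBasis.basis.coord ⟨f n, h1⟩ (e n + f n) = 0 :=
    hE'.isBasis.coord_ne (e := ⟨f n, h1⟩) (f := ⟨e n + f n, h2⟩) fun h =>
      he n (add_eq_right.1 (congrArg Subtype.val h))
  rw [map_add, h3] at h4
  rw [eq_neg_of_add_eq_zero_left h4]
  exact neg_ne_zero.2 one_ne_zero

/-- The automorphism `1 + N` for `N² = 0`. -/
theorem exists_one_add {N : V →ₗ[ℂ] V} (hN : N ∘ₗ N = 0) :
    ∃ g : V ≃ₗ[ℂ] V, (∀ x, g x = x + N x) ∧ ∀ x, g.symm x = x - N x := by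
  have hN' : ∀ x, N (N x) = 0 := fun x => LinearMap.congr_fun hN x
  exact ⟨LinearEquiv.ofLinearMap (LinearMap.id + N) (LinearMap.id - N)
    (by ext x; simp [hN']) (by ext x; simp [hN']), fun x => rfl, fun x => rfl⟩

/-- The shear moves infinitely many basis vectors, hence is not in `G`, but it still preserves
`V_*`, which is enough for admissibility: `f_n^* ∘ N = e_n^*`, and the other coordinate forms kill
the image of `N`. -/
theorem ClassicalType.exists_isAdmissible_shear_A {Vs : Submodule ℂ (Dual ℂ V)} {h1 h2}
    {E₀ : Set V} (hE₀ : (ClassicalType.A Vs h1 h2).IsAdmissible E₀) {e f : ℕ → E₀}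
    (he : Function.Injective e) (hf : Function.Injective f) (hef : ∀ m n, e m ≠ f n) :
    ∃ E, (ClassicalType.A Vs h1 h2).IsAdmissible E ∧ ∀ n, (f n : V) ∈ E ∧ (e n + f n : V) ∈ E := by
  have hb := hE₀.isBasis
  let N₀ : E₀ → V := Function.extend e (fun n => (f n : V)) 0
  have hN₀e : ∀ n, N₀ (e n) = f n := fun n => he.extend_apply _ _ n
  have hN₀' : ∀ x, (∀ n, e n ≠ x) → N₀ x = 0 := fun x hx =>
    Function.extend_apply' _ _ _ fun ⟨n, hn⟩ => hx n hn
  let N : V →ₗ[ℂ] V := hb.basis.constr ℂ N₀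
  have hN : ∀ x : E₀, N x = N₀ x := fun x => by
    have := hb.basis.constr_basis ℂ N₀ x
    rwa [hb.basis_apply] at this
  have hNf : ∀ n, N (f n) = 0 := fun n => by rw [hN, hN₀' _ fun m => hef m n]
  have hN2 : N ∘ₗ N = 0 := by
    refine hb.basis.ext fun x => ?_
    rw [hb.basis_apply, LinearMap.comp_apply, hN, LinearMap.zero_apply]
    by_cases hx : ∃ n, e n = x
    · obtain ⟨n, rfl⟩ := hx
      rw [hN₀e, hNf]
    · rw [hN₀' x (not_exists.1 hx), map_zero]
  obtain ⟨g, hg, hg'⟩ := exists_one_add hN2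
  have hdual : ∀ φ ∈ Vs, φ ∘ₗ N ∈ Vs := by
    intro φ hφ
    have hspan : Submodule.span ℂ (Set.range hb.basis.coord) = Vs := hE₀.span_coord
    rw [← hspan] at hφ
    induction hφ using Submodule.span_induction with
    | mem φ h =>
      obtain ⟨y, rfl⟩ := h
      by_cases hy : ∃ n, f n = y
      · obtain ⟨n, rfl⟩ := hy
        have : hb.basis.coord (f n) ∘ₗ N = hb.basis.coord (e n) := by
          refine hb.basis.ext fun x => ?_
          rw [hb.basis_apply, LinearMap.comp_apply, hN]
          by_cases hx : ∃ m, e m = x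
          · obtain ⟨m, rfl⟩ := hx
            rw [hN₀e]
            by_cases hmn : m = n
            · rw [hmn, hb.coord_self, hb.coord_self]
            · rw [hb.coord_ne (hf.ne hmn), hb.coord_ne (he.ne hmn)]
          · rw [hN₀' x (not_exists.1 hx), map_zero, hb.coord_ne fun h => hx ⟨n, h.symm⟩]
        rw [this]
        exact hE₀.coord_mem (e n)
      · have : hb.basis.coord y ∘ₗ N = 0 := by
          refine hb.basis.ext fun x => ?_
          rw [hb.basis_apply, LinearMap.comp_apply, hN]
          by_cases hx : ∃ m, e m = x
          · obtain ⟨m, rfl⟩ := hx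
            rw [hN₀e, hb.coord_ne (not_exists.1 hy m), LinearMap.zero_apply]
          · rw [hN₀' x (not_exists.1 hx), map_zero, LinearMap.zero_apply]
        rw [this]
        exact zero_mem _
    | zero => simp
    | add φ ψ _ _ h1 h2 => exact add_mem h1 h2
    | smul c φ _ h1 => exact Vs.smul_mem c h1
  refine ⟨g '' E₀, ClassicalType.isAdmissible_image_A hE₀ (le_antisymm ?_ fun φ hφ => ?_),
    fun n => ⟨⟨f n, (f n).2, ?_⟩, ⟨e n, (e n).2, ?_⟩⟩⟩
  · rintro _ ⟨φ, hφ, rfl⟩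
    have : dualAct g φ = φ - φ ∘ₗ N := LinearMap.ext fun x => by simp [hg']
    rw [this]
    exact sub_mem hφ (hdual φ hφ)
  · refine ⟨φ + φ ∘ₗ N, add_mem hφ (hdual φ hφ), LinearMap.ext fun x => ?_⟩
    have := LinearMap.congr_fun hN2 x
    rw [LinearMap.comp_apply, LinearMap.zero_apply] at this
    simp [hg', this]
  · rw [hg, hNf, add_zero]
  · rw [hg, hN, hN₀e]

/-- Sending `e n` to `e n + f n` forces a compensating term on `i (f n)`. With it `N` is skew for
`ω`; its image is isotropic, so `1 + N` is an isometry. -/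
theorem IsForm.exists_isAdmissible_shear {T : ClassicalType V} {ω : LinearMap.BilinForm ℂ V}
    {ε : ℂ} (hω : IsForm T ω ε) {E₀ : Set V} (hE₀ : T.IsAdmissible E₀) {i : E₀ → E₀}
    (hi : Function.Involutive i) (hi' : ∀ x y : E₀, ω (x : V) (y : V) ≠ 0 ↔ y = i x)
    {e f : ℕ → E₀} (he : Function.Injective e) (hf : Function.Injective f)
    (hef : ∀ m n, e m ≠ f n) (hee : ∀ m n, e m ≠ i (e n)) (hff : ∀ m n, f m ≠ i (f n))
    (hef' : ∀ m n, e m ≠ i (f n)) :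
    ∃ E, T.IsAdmissible E ∧ ∀ n, (f n : V) ∈ E ∧ (e n + f n : V) ∈ E := by
  have hb := hE₀.isBasis
  have hi0 : ∀ x y : E₀, y ≠ i x → ω (x : V) (y : V) = 0 := fun x y h =>
    not_not.1 (mt (hi' x y).1 h)
  have hfe' : ∀ m n, f m ≠ i (e n) := fun m n h => hef' n m (by rw [h, hi])
  have hii : ∀ x y, i x = i y → x = y := fun x y h => hi.injective h
  -- The solution of `ω(f_n, i f_n) - c_n ω(e_n, i e_n) = 0`, which is skewness of `N` on the pair
  -- `e_n`, `i f_n`.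
  let c : ℕ → ℂ := fun n => ω (f n : V) (i (f n)) / ω (e n : V) (i (e n))
  have hif : Function.Injective fun n => i (f n) := hi.injective.comp hf
  let N₀ : E₀ → V := Function.extend e (fun n => (f n : V))
    (Function.extend (fun n => i (f n)) (fun n => -(c n • (i (e n) : V))) 0)
  have hN₀e : ∀ n, N₀ (e n) = f n := fun n => he.extend_apply _ _ n
  have hN₀f : ∀ n, N₀ (i (f n)) = -(c n • (i (e n) : V)) := fun n =>
    (Function.extend_apply' _ _ _ fun ⟨m, hm⟩ => hef' m n hm).trans (hif.extend_apply _ _ n)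
  have hN₀' : ∀ x, (∀ n, e n ≠ x) → (∀ n, i (f n) ≠ x) → N₀ x = 0 := fun x hx hx' =>
    (Function.extend_apply' _ _ _ fun ⟨n, hn⟩ => hx n hn).trans
      (Function.extend_apply' _ _ _ fun ⟨n, hn⟩ => hx' n hn)
  let N : V →ₗ[ℂ] V := hb.basis.constr ℂ N₀
  have hN : ∀ x : E₀, N x = N₀ x := fun x => by
    have := hb.basis.constr_basis ℂ N₀ x
    rwa [hb.basis_apply] at this
  have hNf : ∀ n, N (f n) = 0 := fun n => by
    rw [hN, hN₀' _ (fun m => hef m n) fun m => (hff n m).symm]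
  have hNie : ∀ n, N (i (e n)) = 0 := fun n => by
    rw [hN, hN₀' _ (fun m => hee m n) fun m h => hef n m (hii _ _ h).symm]
  have hcases : ∀ x : E₀, (∃ n, e n = x) ∨ (∃ n, i (f n) = x) ∨
      ((∀ n, e n ≠ x) ∧ ∀ n, i (f n) ≠ x) := fun x => by
    by_cases h1 : ∃ n, e n = x
    · exact Or.inl h1
    · by_cases h2 : ∃ n, i (f n) = x
      · exact Or.inr (Or.inl h2)
      · exact Or.inr (Or.inr ⟨not_exists.1 h1, not_exists.1 h2⟩)
  have hN2 : N ∘ₗ N = 0 := by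
    refine hb.basis.ext fun x => ?_
    rw [hb.basis_apply, LinearMap.comp_apply, hN, LinearMap.zero_apply]
    obtain ⟨n, rfl⟩ | ⟨n, rfl⟩ | ⟨h1, h2⟩ := hcases x
    · rw [hN₀e, hNf]
    · rw [hN₀f, map_neg, map_smul, hNie, smul_zero, neg_zero]
    · rw [hN₀' x h1 h2, map_zero]
  have hNN₀ : ∀ x y : E₀, ω (N₀ x) (N₀ y) = 0 := by
    have h1 : ∀ m n, ω (f m : V) (f n) = 0 := fun m n => hi0 _ _ (hff n m)
    have h2 : ∀ m n, ω (f m : V) (i (e n)) = 0 := fun m n => hi0 _ _ fun h =>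
      hef n m (hii _ _ h)
    have h3 : ∀ m n, ω (i (e m) : V) (f n) = 0 := fun m n => hω.eq_zero_comm.1 (h2 n m)
    have h4 : ∀ m n, ω (i (e m) : V) (i (e n)) = 0 := fun m n => hi0 _ _ fun h =>
      hee m n (by rw [h, hi])
    intro x y
    obtain ⟨m, rfl⟩ | ⟨m, rfl⟩ | ⟨hx1, hx2⟩ := hcases x
    · obtain ⟨n, rfl⟩ | ⟨n, rfl⟩ | ⟨hy1, hy2⟩ := hcases y
      · rw [hN₀e, hN₀e, h1]
      · rw [hN₀e, hN₀f, map_neg, map_smul, h2, smul_zero, neg_zero]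
      · rw [hN₀' y hy1 hy2, map_zero]
    · obtain ⟨n, rfl⟩ | ⟨n, rfl⟩ | ⟨hy1, hy2⟩ := hcases y
      · simp [hN₀e, hN₀f, h3]
      · simp [hN₀f, h4]
      · rw [hN₀' y hy1 hy2, map_zero]
    · rw [hN₀' x hx1 hx2, map_zero, LinearMap.zero_apply]
  have hskew : ∀ x y : E₀, ω (N₀ x) (y : V) + ω (x : V) (N₀ y) = 0 := by
    have hsymm : ∀ x y : E₀, ω (N₀ x) (y : V) + ω (x : V) (N₀ y) = 0 →
        ω (N₀ y) (x : V) + ω (y : V) (N₀ x) = 0 := fun x y h => by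
      rw [hω.symm (N₀ y), hω.symm y, ← mul_add, add_comm, h, mul_zero]
    have hA : ∀ n (y : E₀), ω (N₀ (e n)) (y : V) + ω (e n : V) (N₀ y) = 0 := by
      intro n y
      rw [hN₀e]
      obtain ⟨m, rfl⟩ | ⟨m, rfl⟩ | ⟨h1, h2⟩ := hcases y
      · rw [hN₀e, hi0 _ _ (hef' m n), hi0 _ _ (hfe' m n), add_zero]
      · rw [hN₀f, map_neg, map_smul]
        by_cases hmn : m = n
        · subst hmn
          have : ω (e m : V) (i (e m)) ≠ 0 := (hi' _ _).2 rfl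
          simp only [c, smul_eq_mul]
          field_simp
          ring
        · rw [hi0 (f n) (i (f m)) fun h => hmn (hf (hii _ _ h)),
            hi0 (e n) (i (e m)) fun h => hmn (he (hii _ _ h)), smul_zero, neg_zero, add_zero]
      · rw [hN₀' y h1 h2, hi0 _ _ (h2 n).symm, map_zero, add_zero]
    have hB : ∀ n (y : E₀), (∀ m, e m ≠ y) →
        ω (N₀ (i (f n))) (y : V) + ω (i (f n) : V) (N₀ y) = 0 := by
      intro n y hy
      have h1 : ω (i (e n) : V) y = 0 := hi0 _ _ (by rw [hi]; exact (hy n).symm)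
      rw [hN₀f, map_neg, LinearMap.neg_apply, map_smul, LinearMap.smul_apply, h1, smul_zero,
        neg_zero, zero_add]
      obtain ⟨m, rfl⟩ | ⟨m, rfl⟩ | ⟨-, h2⟩ := hcases y
      · exact absurd rfl (hy m)
      · rw [hN₀f, map_neg, map_smul, hi0 (i (f n)) (i (e m)), smul_zero, neg_zero]
        rw [hi]
        exact (hfe' n m).symm
      · rw [hN₀' y hy h2, map_zero]
    intro x y
    obtain ⟨m, rfl⟩ | ⟨m, rfl⟩ | ⟨hx1, hx2⟩ := hcases x
    · exact hA m y
    · obtain ⟨n, rfl⟩ | ⟨n, rfl⟩ | ⟨hy1, hy2⟩ := hcases y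
      · exact hsymm _ _ (hA n _)
      · exact hB m _ fun k => hef' k n
      · exact hB m y hy1
    · obtain ⟨n, rfl⟩ | ⟨n, rfl⟩ | ⟨hy1, hy2⟩ := hcases y
      · exact hsymm _ _ (hA n _)
      · exact hsymm _ _ (hB n x hx1)
      · rw [hN₀' x hx1 hx2, hN₀' y hy1 hy2, map_zero, map_zero, LinearMap.zero_apply, add_zero]
  obtain ⟨g, hg, -⟩ := exists_one_add hN2
  have hgω : ∀ x y, ω (g x) (g y) = ω x y := by
    have : ω.compl₁₂ g.toLinearMap g.toLinearMap = ω := by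
      refine hb.basis.ext fun x => hb.basis.ext fun y => ?_
      rw [hb.basis_apply, hb.basis_apply]
      change ω (g x) (g y) = ω x y
      rw [hg, hg, hN, hN]
      simp only [map_add, LinearMap.add_apply]
      linear_combination hskew x y + hNN₀ x y
    exact fun x y => LinearMap.congr_fun₂ this x y
  refine ⟨g '' E₀, hω.isAdmissible_image hE₀ hgω,
    fun n => ⟨⟨f n, (f n).2, ?_⟩, ⟨e n, (e n).2, ?_⟩⟩⟩
  · rw [hg, hNf, add_zero]
  · rw [hg, hN, hN₀e]

/-- A flag which is weakly compatible with every admissible basis is nearly trivial. -/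
theorem isNearlyTrivial_of_isWeaklyCompatible {T : ClassicalType V}
    (hV : Module.rank ℂ V = Cardinal.aleph0) {𝓕 : Set (Submodule ℂ V)}
    (h𝓕 : ∀ F ∈ 𝓕, ∀ K ∈ 𝓕, F ≤ K ∨ K ≤ F) {E₀ : Set V} (hE₀ : T.IsAdmissible E₀)
    (h : ∀ E : Set V, T.IsAdmissible E → T.IsWeaklyCompatible E 𝓕) : IsNearlyTrivial E₀ 𝓕 := by
  by_contra hcon
  have hb := hE₀.isBasis
  have key : ∃ e f : ℕ → E₀, Function.Injective e ∧ Function.Injective f ∧ (∀ m n, e m ≠ f n) ∧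
      (∀ n, ∃ F ∈ 𝓕, (e n : V) ∈ F ∧ (f n : V) ∉ F) ∧
      ∃ E, T.IsAdmissible E ∧ ∀ n, (f n : V) ∈ E ∧ (e n + f n : V) ∈ E := by
    have hsep : ∀ {a b : E₀}, (∃ F ∈ 𝓕, (a : V) ∈ F ∧ (b : V) ∉ F) → a ≠ b := by
      rintro a _ ⟨F, -, ha, hb⟩ rfl
      exact hb ha
    rcases T.cases with ⟨Vs, h1, h2, rfl⟩ | ⟨ω, ε, hω⟩
    · obtain ⟨p, hp, hpp⟩ := exists_seq_of_not_isNearlyTrivial (hb.infinite hV) hcon (j := id)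
        (fun _ => rfl) Set.finite_empty
      have he : Function.Injective fun n => (p n).1 := fun m n h => by
        by_contra hmn
        exact (hpp hmn).1 h
      have hf : Function.Injective fun n => (p n).2 := fun m n h => by
        by_contra hmn
        exact (hpp hmn).2.2.2.1 h
      have hef : ∀ m n, (p m).1 ≠ (p n).2 := fun m n => by
        by_cases hmn : m = n
        · subst hmn
          exact hsep (hp m).2.2.2
        · exact (hpp hmn).2.1
      exact ⟨_, _, he, hf, hef, fun n => (hp n).2.2.2,
        ClassicalType.exists_isAdmissible_shear_A hE₀ he hf hef⟩
    · obtain ⟨-, i, hi, hfix, hi'⟩ := (hω.admissible_iff E₀).1 hE₀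
      -- Avoiding the fixed point of `i` guarantees that no `e n` or `f n` is its own partner.
      obtain ⟨p, hp, hpp⟩ := exists_seq_of_not_isNearlyTrivial (hb.infinite hV) hcon hi
        hfix.finite
      have he : Function.Injective fun n => (p n).1 := fun m n h => by
        by_contra hmn
        exact (hpp hmn).1 h
      have hf : Function.Injective fun n => (p n).2 := fun m n h => by
        by_contra hmn
        exact (hpp hmn).2.2.2.1 h
      have hef : ∀ m n, (p m).1 ≠ (p n).2 := fun m n => by
        by_cases hmn : m = n
        · subst hmn
          exact hsep (hp m).2.2.2
        · exact (hpp hmn).2.1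
      refine ⟨_, _, he, hf, hef, fun n => (hp n).2.2.2,
        hω.exists_isAdmissible_shear hE₀ hi hi' he hf hef ?_ ?_ ?_⟩
      · intro m n
        by_cases hmn : m = n
        · subst hmn
          exact fun h => (hp m).1 h.symm
        · exact (hpp hmn).2.2.2.2.1
      · intro m n
        by_cases hmn : m = n
        · subst hmn
          exact fun h => (hp m).2.1 h.symm
        · exact (hpp hmn).2.2.2.2.2.2.2
      · intro m n
        by_cases hmn : m = n
        · subst hmn
          exact fun h => (hp m).2.2.1 (by rw [h, hi])
        · exact (hpp hmn).2.2.2.2.2.1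
  obtain ⟨e, f, he, hf, hef, hF, E, hE, hmem⟩ := key
  have hne : ∀ x : E₀, (x : V) ≠ 0 := fun x => by
    rw [← hb.basis_apply x]
    exact hb.basis.ne_zero x
  refine not_isWeaklyCompatible h𝓕 (fun n => hne (e n)) (Subtype.val_injective.comp hf) ?_
    (fun n => (hmem n).1) (fun n => (hmem n).2) hF (h E hE)
  intro m n hmn
  by_contra h
  have h0 : hb.basis.coord (e m) ((e m : V) + f m) = hb.basis.coord (e m) ((e n : V) + f n) :=
    congrArg _ hmn
  rw [map_add, map_add, hb.coord_self, hb.coord_ne (hef m m).symm, hb.coord_ne (hef m n).symm,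
    hb.coord_ne (he.ne (Ne.symm h)), add_zero, add_zero] at h0
  exact one_ne_zero h0

end FlagInd

end

/-! ### The equivalence of the four conditions. -/

theorem proposition1 {V : Type*} [AddCommGroup V] [Module ℂ V]
    (hV : Module.rank ℂ V = Cardinal.aleph0) (T : FlagInd.ClassicalType V)
    (P : Subgroup (V ≃ₗ[ℂ] V)) (hP : T.IsSplittingParabolic P)
    (𝓕 : Set (Submodule ℂ V)) (h𝓕 : T.IsGeneralizedFlag 𝓕) (hP𝓕 : P = T.Stab 𝓕) :
    List.TFAE [
      T.IsLarge P,
      ∀ E : Set V, T.IsAdmissible E → T.IsWeaklyCompatible E 𝓕,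
      ∀ E : Set V, T.IsAdmissible E → ∃ 𝓖 ∈ T.flagOrbit 𝓕, T.IsCompatible E 𝓖,
      ∀ H : Subgroup (V ≃ₗ[ℂ] V), T.IsSplittingCartan H →
        ∃ g ∈ T.G, ∀ h ∈ H, g * h * g⁻¹ ∈ P] := by
  subst hP𝓕
  obtain ⟨-, E₀, hE₀, hH, -⟩ := hP
  have : Nontrivial V := by
    rw [← rank_pos_iff_nontrivial (R := ℂ), hV]
    exact Cardinal.aleph0_pos
  tfae_have 1 → 3 := by
    intro h E hE
    obtain ⟨g, hg, hgF⟩ :=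
      (h.isNearlyTrivial h𝓕.total hE₀ hH).exists_map_compatible hV h𝓕 hE₀ hH hE
    refine ⟨FlagInd.flagMap g 𝓕, ⟨g, hg, rfl⟩, fun k hk => ?_⟩
    rw [FlagInd.flagMap, FlagInd.flagMap, Set.image_image]
    exact Set.image_congr fun F hF => hgF F hF k hk
  tfae_have 3 → 2 := by
    intro h E hE
    obtain ⟨_, ⟨g, hg, rfl⟩, hgE⟩ := h E hE
    exact hgE.isWeaklyCompatible hE hg
  tfae_have 2 → 1 := fun h =>
    (FlagInd.isNearlyTrivial_of_isWeaklyCompatible hV h𝓕.total hE₀ h).isLarge h𝓕 hE₀ hH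
  tfae_have 3 → 4 := by
    rintro h _ ⟨E, hE, rfl⟩
    obtain ⟨_, ⟨g, hg, rfl⟩, hgE⟩ := h E hE
    refine ⟨g⁻¹, inv_mem hg, fun k hk =>
      ⟨mul_mem (mul_mem (inv_mem hg) hk.1) (inv_mem (inv_mem hg)), ?_⟩⟩
    rw [inv_inv]
    exact FlagInd.flagMap_flagMap_eq_iff.1 (hgE k hk)
  tfae_have 4 → 3 := by
    intro h E hE
    obtain ⟨g, hg, hgE⟩ := h _ ⟨E, hE, rfl⟩
    refine ⟨FlagInd.flagMap g⁻¹ 𝓕, ⟨g⁻¹, inv_mem hg, rfl⟩, fun k hk => ?_⟩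
    rw [FlagInd.flagMap_flagMap_eq_iff, inv_inv]
    exact (hgE k hk).2
  tfae_finish
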